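/- All vector spaces and algebras are over $\mathbb{C}$; algebras are associative but need not be unital, and $\odot$ is the algebraic tensor product. An algebra $B$ is non-degenerate if $xB=0$ or $Bx=0$ implies $x=0$; $M(B)$ denotes its multiplier algebra. Let $(A,\Delta)$ be an algebraic quantum group, i.e. a regular multiplier Hopf algebra (a non-degenerate algebra $A$ with a coassociative non-degenerate homomorphism $\Delta:A\to M(A\odot A)$ such that $a\otimes b\mapsto \Delta(a)(b\otimes 1)$, $\Delta(a)(1\otimes b)$, $(b\otimes 1)\Delta(a)$, $(1\otimes b)\Delta(a)$ are bijections of $A\odot A$ onto itself) admitting a non-zero left invariant linear functional $\varphi$. Let $S$ be its antipode, and let $\hat A=\{\varphi(a\,\cdot\,)\mid a\in A\}\subseteq A'$, with the antipode $\hat S(\omega)=\omega\circ S$ of the dual quantum group. Let $B$ be a non-degenerate algebra and let $V$ be a non-degenerate corepresentation of $(A,\Delta)$ on $B$, i.e. an invertible element $V\in M(A\odot B)$ with $(\Delta\odot\iota)(V)=V_{13}V_{23}$. 1. For all $a\in A$, $b\in B$ the elements $(S^{-1}(a)\otimes 1)V(1\otimes b)$ and $(1\otimes b)V(S^{-1}(a)\otimes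 1)$ belong to $A\odot B$, and there is a unique element $(S\odot\iota)(V)\in M(A\odot B)$ such that $$(S\odot\iota)(V)\,(a\otimes b)=(S\odot\iota)\bigl((S^{-1}(a)\otimes 1)V(1\otimes b)\bigr),\qquad (a\otimes b)\,(S\odot\iota)(V)=(S\odot\iota)\bigl((1\otimes b)V(S^{-1}(a)\otimes 1)\bigr)$$ for all $a\in A$, $b\in B$. Moreover $(S\odot\iota)(V)=V^{-1}$. 2. For $W\in M(A\odot B)$ and a functional $\omega=\theta(\,\cdot\,a)$ with $a\in A$, $\theta\in A'$, let $(\omega\odot\iota)(W)$ be given by $(\omega\odot\iota)(W)\,x=(\theta\odot\iota)(W(a\otimes x))$ for $x\in B$, and put $\pi_V(\omega)=(\omega\odot\iota)(V)$. For every $\omega\in\hat A$ one has $\hat S(\omega)\in\hat A$, the slices $(\omega\odot\iota)(V^{-1})$ and $\pi_V(\hat S(\omega))$ are well-defined elements of $M(B)$, and $$(\omega\odot\iota)(V^{-1})=\pi_V(\hat S(\omega)).$$ -/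

import Mathlib

open scoped TensorProduct

noncomputable section

namespace AlgQuantumGroup

section Multipliers

variable {A : Type*} [NonUnitalRing A] [Module ℂ A] [IsScalarTower ℂ A A] [SMulCommClass ℂ A A]
variable {B : Type*} [NonUnitalRing B] [Module ℂ B] [IsScalarTower ℂ B B] [SMulCommClass ℂ B B]
variable {C : Type*} [NonUnitalRing C] [Module ℂ C] [IsScalarTower ℂ C C] [SMulCommClass ℂ C C]
variable {D : Type*} [NonUnitalRing D] [Module ℂ D] [IsScalarTower ℂ D D] [SMulCommClass ℂ D D]

/-- A (not necessarily unital) algebra whose product is non-degenerate on both sides. -/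
def IsNondegenerateAlg (A : Type*) [NonUnitalRing A] : Prop :=
  (∀ a : A, (∀ b : A, a * b = 0) → a = 0) ∧ (∀ a : A, (∀ b : A, b * a = 0) → a = 0)

variable (A) in
/-- The multiplier algebra `M(A)`: pairs `(L, R)` of a left multiplier `L` and a right multiplier
`R` with `R(x) y = x L(y)`.  The element `m = (L, R)` acts by `m x = L(x)` and `x m = R(x)`;
the product of `M(A)` composes the `L`'s in order and the `R`'s in the opposite order. -/
def multiplierAlgebra : Subalgebra ℂ (Module.End ℂ A × (Module.End ℂ A)ᵐᵒᵖ) where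
  carrier := {m | (∀ x y, m.1 (x * y) = m.1 x * y) ∧
    (∀ x y, m.2.unop (x * y) = x * m.2.unop y) ∧ ∀ x y, m.2.unop x * y = x * m.1 y}
  mul_mem' := by
    rintro m n ⟨h1, h2, h3⟩ ⟨k1, k2, k3⟩
    refine ⟨fun x y => ?_, fun x y => ?_, fun x y => ?_⟩ <;> simp [h1, h2, h3, k1, k2, k3]
  add_mem' := by
    rintro m n ⟨h1, h2, h3⟩ ⟨k1, k2, k3⟩
    refine ⟨fun x y => ?_, fun x y => ?_, fun x y => ?_⟩ <;>
      simp [h1, h2, h3, k1, k2, k3, add_mul, mul_add]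
  algebraMap_mem' := by
    intro r
    refine ⟨fun x y => ?_, fun x y => ?_, fun x y => ?_⟩ <;>
      simp [Algebra.algebraMap_eq_smul_one, smul_mul_assoc, mul_smul_comm]

variable (A) in
/-- The multiplier algebra as a type; it is a unital `ℂ`-algebra. -/
abbrev Mult : Type _ := ↥(multiplierAlgebra A)

namespace Mult

/-- `m.lmul x` is the product `m x`. -/
def lmul (m : Mult A) : A →ₗ[ℂ] A := m.1.1

/-- `m.rmul x` is the product `x m`. -/
def rmul (m : Mult A) : A →ₗ[ℂ] A := m.1.2.unop

/-- A multiplier from its two actions. -/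
def mk (L R : A →ₗ[ℂ] A) (hL : ∀ x y, L (x * y) = L x * y) (hR : ∀ x y, R (x * y) = x * R y)
    (h : ∀ x y, R x * y = x * L y) : Mult A :=
  ⟨(L, MulOpposite.op R), hL, hR, h⟩

theorem ext {m n : Mult A} (hl : ∀ x, m.lmul x = n.lmul x) (hr : ∀ x, m.rmul x = n.rmul x) :
    m = n :=
  Subtype.ext (Prod.ext (LinearMap.ext hl) (MulOpposite.unop_injective (LinearMap.ext hr)))

theorem lmul_apply_mul (m : Mult A) (x y : A) : m.lmul (x * y) = m.lmul x * y := m.2.1 x y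

theorem rmul_apply_mul (m : Mult A) (x y : A) : m.rmul (x * y) = x * m.rmul y := m.2.2.1 x y

theorem rmul_mul (m : Mult A) (x y : A) : m.rmul x * y = x * m.lmul y := m.2.2.2 x y

theorem mul_lmul (m n : Mult A) (x : A) : (m * n).lmul x = m.lmul (n.lmul x) := rfl

theorem mul_rmul (m n : Mult A) (x : A) : (m * n).rmul x = n.rmul (m.rmul x) := rfl

variable (A) in
/-- The canonical map `A → M(A)`. -/
def incl : A →ₙₐ[ℂ] Mult A where
  toFun a := mk (LinearMap.mulLeft ℂ a) (LinearMap.mulRight ℂ a)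
    (fun x y => by simp [mul_assoc]) (fun x y => by simp [mul_assoc])
    (fun x y => by simp [mul_assoc])
  map_smul' r a := ext (fun x => smul_mul_assoc r a x) (fun x => mul_smul_comm r x a)
  map_zero' := ext (fun x => zero_mul x) (fun x => mul_zero x)
  map_add' a b := ext (fun x => add_mul a b x) (fun x => mul_add x a b)
  map_mul' a b := ext (fun x => mul_assoc a b x) (fun x => (mul_assoc x a b).symm)

theorem incl_lmul (a x : A) : (incl A a).lmul x = a * x := rfl

theorem incl_rmul (a x : A) : (incl A a).rmul x = x * a := rfl

/-- The multiplier `m ⊗ n` of `A ⊙ B`, for `m ∈ M(A)` and `n ∈ M(B)`. -/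
def tmul (m : Mult A) (n : Mult B) : Mult (A ⊗[ℂ] B) :=
  mk (TensorProduct.map m.lmul n.lmul) (TensorProduct.map m.rmul n.rmul)
    (fun x y => by
      induction x with
      | zero => simp
      | add x x' hx hx' => simp only [add_mul, map_add, hx, hx']
      | tmul a b =>
        induction y with
        | zero => simp
        | add y y' hy hy' => simp only [mul_add, map_add, hy, hy']
        | tmul c d => simp [lmul_apply_mul])
    (fun x y => by
      induction x with
      | zero => simp
      | add x x' hx hx' => simp only [add_mul, map_add, hx, hx']
      | tmul a b =>
        induction y with
        | zero => simp
        | add y y' hy hy' => simp only [mul_add, map_add, hy, hy']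
        | tmul c d => simp [rmul_apply_mul])
    (fun x y => by
      induction x with
      | zero => simp
      | add x x' hx hx' => simp only [add_mul, map_add, hx, hx']
      | tmul a b =>
        induction y with
        | zero => simp
        | add y y' hy hy' => simp only [mul_add, map_add, hy, hy']
        | tmul c d => simp [rmul_mul])

variable (A B) in
/-- `tmul` as a bilinear map. -/
def tmulₗ : Mult A →ₗ[ℂ] Mult B →ₗ[ℂ] Mult (A ⊗[ℂ] B) :=
  LinearMap.mk₂ ℂ tmul
    (fun m m' n => ext
      (fun x => LinearMap.congr_fun (TensorProduct.map_add_left m.lmul m'.lmul n.lmul) x)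
      (fun x => LinearMap.congr_fun (TensorProduct.map_add_left m.rmul m'.rmul n.rmul) x))
    (fun r m n => ext
      (fun x => LinearMap.congr_fun (TensorProduct.map_smul_left r m.lmul n.lmul) x)
      (fun x => LinearMap.congr_fun (TensorProduct.map_smul_left r m.rmul n.rmul) x))
    (fun m n n' => ext
      (fun x => LinearMap.congr_fun (TensorProduct.map_add_right m.lmul n.lmul n'.lmul) x)
      (fun x => LinearMap.congr_fun (TensorProduct.map_add_right m.rmul n.rmul n'.rmul) x))
    (fun r m n => ext
      (fun x => LinearMap.congr_fun (TensorProduct.map_smul_right r m.lmul n.lmul) x)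
      (fun x => LinearMap.congr_fun (TensorProduct.map_smul_right r m.rmul n.rmul) x))

/-- Transport of multipliers along an isomorphism of algebras. -/
def congr (e : C ≃ₗ[ℂ] D) (he : ∀ x y, e (x * y) = e x * e y) (m : Mult C) : Mult D :=
  have he' : ∀ x y, e.symm (x * y) = e.symm x * e.symm y := fun x y => by
    apply e.injective; simp [he]
  mk (e.toLinearMap ∘ₗ m.lmul ∘ₗ e.symm.toLinearMap)
    (e.toLinearMap ∘ₗ m.rmul ∘ₗ e.symm.toLinearMap)
    (fun x y => by simp [he, he', lmul_apply_mul])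
    (fun x y => by simp [he, he', rmul_apply_mul])
    (fun x y => by
      have h := congrArg e (m.rmul_mul (e.symm x) (e.symm y))
      simpa [he] using h)

/-- A multiplicative linear map `π : C → M(D)` is non-degenerate if `π(C) D = D = D π(C)`
(linear spans of products). -/
def IsNondegenerateHom (π : C →ₙₐ[ℂ] Mult D) : Prop :=
  Submodule.span ℂ {d : D | ∃ c d', d = (π c).lmul d'} = ⊤ ∧
    Submodule.span ℂ {d : D | ∃ c d', d = (π c).rmul d'} = ⊤

/-- `n ∈ M(D)` is a value at `m ∈ M(C)` of a multiplicative extension of `π : C → M(D)`: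
`n π(c) = π(m c)` and `π(c) n = π(c m)` for all `c ∈ C`. -/
def IsExtensionAt (π : C →ₗ[ℂ] Mult D) (m : Mult C) (n : Mult D) : Prop :=
  ∀ c : C, n * π c = π (m.lmul c) ∧ π c * n = π (m.rmul c)

open Classical in
/-- The multiplicative extension of `π : C → M(D)` to `M(C)`. It exists and is unique for the
maps used below, see `existsUnique_extension_tensor_id`, `existsUnique_extension_id_tensor`. -/
def extend (π : C →ₗ[ℂ] Mult D) (m : Mult C) : Mult D :=
  if h : ∃ n, IsExtensionAt π m n then h.choose else 0

/-- The map `π ⊙ σ : A ⊙ B → M(C ⊙ D)` for `π : A → M(C)` and `σ : B → M(D)`. -/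
def tensorHom (π : A →ₗ[ℂ] Mult C) (σ : B →ₗ[ℂ] Mult D) :
    A ⊗[ℂ] B →ₗ[ℂ] Mult (C ⊗[ℂ] D) :=
  TensorProduct.lift ((tmulₗ C D).compl₁₂ π σ)

theorem incl_injective (hD : IsNondegenerateAlg D) : Function.Injective (incl D) := by
  intro x y h
  refine sub_eq_zero.1 (hD.1 _ fun b => ?_)
  have := congrArg (fun t => t.lmul b) h
  simp only [incl_lmul] at this
  rw [sub_mul, this, sub_self]

theorem mul_incl (m : Mult D) (x : D) : m * incl D x = incl D (m.lmul x) :=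
  ext (fun y => lmul_apply_mul m x y) (fun y => rmul_mul m y x)

theorem incl_mul (m : Mult D) (x : D) : incl D x * m = incl D (m.rmul x) :=
  ext (fun y => (rmul_mul m x y).symm) (fun y => rmul_apply_mul m y x)

/-- Existence and uniqueness of the value at `m ∈ M(C)` of the extension of a multiplicative
map `π : C → M(D)` for which `π(C) σ(E)` and `σ(E) π(C)` span `D`, for some `σ : E → M(D)`. -/
theorem existsUnique_isExtensionAt_aux {E : Type*} [AddCommGroup E] [Module ℂ E]
    (hD : IsNondegenerateAlg D) (π : C →ₗ[ℂ] Mult D) (hπ : ∀ a b, π (a * b) = π a * π b)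
    (σ : E → Mult D) (K K' : C ⊗[ℂ] E →ₗ[ℂ] D)
    (hK : ∀ c e, incl D (K (c ⊗ₜ e)) = π c * σ e)
    (hK' : ∀ c e, incl D (K' (c ⊗ₜ e)) = σ e * π c)
    (sK : Function.Surjective K) (sK' : Function.Surjective K') (m : Mult C) :
    ∃! n : Mult D, IsExtensionAt π m n := by
  have inj := incl_injective hD
  let Km : C ⊗[ℂ] E →ₗ[ℂ] D := K ∘ₗ m.lmul.rTensor E
  let Km' : C ⊗[ℂ] E →ₗ[ℂ] D := K' ∘ₗ m.rmul.rTensor E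
  have eKm : ∀ c e, incl D (Km (c ⊗ₜ e)) = π (m.lmul c) * σ e := fun c e => hK _ _
  have eKm' : ∀ c e, incl D (Km' (c ⊗ₜ e)) = σ e * π (m.rmul c) := fun c e => hK' _ _
  have key : ∀ z w, K' z * Km w = Km' z * K w := by
    intro z w
    induction z with
    | zero => simp
    | add z z' hz hz' => simp only [map_add, add_mul, hz, hz']
    | tmul c d =>
      induction w with
      | zero => simp
      | add w w' hw hw' => simp only [map_add, mul_add, hw, hw']
      | tmul a b =>
        apply inj
        rw [map_mul, map_mul, hK', eKm, eKm', hK]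
        calc σ d * π c * (π (m.lmul a) * σ b) = σ d * (π c * π (m.lmul a)) * σ b := by
              simp only [mul_assoc]
          _ = σ d * (π (m.rmul c) * π a) * σ b := by rw [← hπ, ← hπ, rmul_mul]
          _ = _ := by simp only [mul_assoc]
  have hk : ∀ w, K w = 0 → Km w = 0 := by
    intro w hw
    refine hD.2 _ fun b => ?_
    obtain ⟨z, rfl⟩ := sK' b
    rw [key, hw, mul_zero]
  have hk' : ∀ z, K' z = 0 → Km' z = 0 := by
    intro z hz
    refine hD.1 _ fun b => ?_
    obtain ⟨w, rfl⟩ := sK b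
    rw [← key, hz, zero_mul]
  obtain ⟨L, hL⟩ : ∃ L : D →ₗ[ℂ] D, ∀ w, L (K w) = Km w :=
    ⟨(LinearMap.ker K).liftQ Km (fun w hw => hk w hw) ∘ₗ
      (K.quotKerEquivOfSurjective sK).symm.toLinearMap, fun w => by
        have : (K.quotKerEquivOfSurjective sK).symm (K w) = Submodule.Quotient.mk w := by
          rw [LinearEquiv.symm_apply_eq]; rfl
        simp only [LinearMap.comp_apply, LinearEquiv.coe_coe, this]
        rfl⟩
  obtain ⟨R, hR⟩ : ∃ R : D →ₗ[ℂ] D, ∀ w, R (K' w) = Km' w :=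
    ⟨(LinearMap.ker K').liftQ Km' (fun w hw => hk' w hw) ∘ₗ
      (K'.quotKerEquivOfSurjective sK').symm.toLinearMap, fun w => by
        have : (K'.quotKerEquivOfSurjective sK').symm (K' w) = Submodule.Quotient.mk w := by
          rw [LinearEquiv.symm_apply_eq]; rfl
        simp only [LinearMap.comp_apply, LinearEquiv.coe_coe, this]
        rfl⟩
  have cen : ∀ x y, R x * y = x * L y := by
    intro x y
    obtain ⟨z, rfl⟩ := sK' x
    obtain ⟨w, rfl⟩ := sK y
    rw [hL, hR, key]
  have cL : ∀ x y, L (x * y) = L x * y := by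
    intro x y
    refine sub_eq_zero.1 (hD.2 _ fun b => ?_)
    rw [mul_sub, ← mul_assoc, ← cen, ← cen, mul_assoc, sub_self]
  have cR : ∀ x y, R (x * y) = x * R y := by
    intro x y
    refine sub_eq_zero.1 (hD.1 _ fun b => ?_)
    rw [sub_mul, mul_assoc, cen, cen, mul_assoc, sub_self]
  -- two multipliers with the same left actions, or the same right actions, agree
  have eqL : ∀ p q : Mult D, (∀ x, p.lmul x = q.lmul x) → p = q := fun p q h =>
    ext h fun x => sub_eq_zero.1 (hD.1 _ fun b => by
      rw [sub_mul, rmul_mul, rmul_mul, h, sub_self])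
  have eqR : ∀ p q : Mult D, (∀ x, p.rmul x = q.rmul x) → p = q := fun p q h =>
    ext (fun x => sub_eq_zero.1 (hD.2 _ fun b => by
      rw [mul_sub, ← rmul_mul, ← rmul_mul, h, sub_self])) h
  have lK : ∀ c a e, (π c).lmul (K (a ⊗ₜ e)) = K ((c * a) ⊗ₜ e) := fun c a e => by
    apply inj; rw [← mul_incl, hK, hK, hπ, mul_assoc]
  have rK : ∀ c a e, (π c).rmul (K' (a ⊗ₜ e)) = K' ((a * c) ⊗ₜ e) := fun c a e => by
    apply inj; rw [← incl_mul, hK', hK', hπ, mul_assoc]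
  refine ⟨mk L R cL cR cen, fun c => ⟨eqL _ _ fun x => ?_, eqR _ _ fun x => ?_⟩,
    fun n hn => eqL _ _ fun x => ?_⟩
  · obtain ⟨w, rfl⟩ := sK x
    change L ((π c).lmul (K w)) = (π (m.lmul c)).lmul (K w)
    induction w with
    | zero => simp
    | add w w' hw hw' => simp only [map_add, hw, hw']
    | tmul a e =>
      rw [lK, hL, lK, ← lmul_apply_mul]
      rfl
  · obtain ⟨w, rfl⟩ := sK' x
    change R ((π c).rmul (K' w)) = (π (m.rmul c)).rmul (K' w)
    induction w with
    | zero => simp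
    | add w w' hw hw' => simp only [map_add, hw, hw']
    | tmul a e =>
      rw [rK, hR, rK, ← rmul_apply_mul]
      rfl
  · obtain ⟨w, rfl⟩ := sK x
    change n.lmul (K w) = L (K w)
    rw [hL]
    induction w with
    | zero => simp
    | add w w' hw hw' => simp only [map_add, hw, hw']
    | tmul a e => apply inj; rw [← mul_incl, hK, eKm, ← mul_assoc, (hn a).1]

theorem tmul_mul (m m' : Mult A) (n n' : Mult B) :
    tmul m n * tmul m' n' = tmul (m * m') (n * n') := by
  refine ext (fun x => ?_) (fun x => ?_)
  · induction x with
    | zero => simp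
    | add x y hx hy => simp only [map_add, hx, hy]
    | tmul c d => rfl
  · induction x with
    | zero => simp
    | add x y hx hy => simp only [map_add, hx, hy]
    | tmul c d => rfl

set_option linter.unusedSectionVars false in
theorem tensorHom_tmul (π : A →ₗ[ℂ] Mult C) (σ : B →ₗ[ℂ] Mult D) (a : A) (b : B) :
    tensorHom π σ (a ⊗ₜ b) = tmul (π a) (σ b) := by
  simp [tensorHom, tmulₗ]

theorem incl_tmul (a : A) (b : B) : incl (A ⊗[ℂ] B) (a ⊗ₜ b) = tmul (incl A a) (incl B b) :=
  ext (fun x => by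
      induction x with
      | zero => simp
      | add x y hx hy => simp only [map_add, hx, hy]
      | tmul c d => exact Algebra.TensorProduct.tmul_mul_tmul a c b d)
    (fun x => by
      induction x with
      | zero => simp
      | add x y hx hy => simp only [map_add, hx, hy]
      | tmul c d => exact Algebra.TensorProduct.tmul_mul_tmul c a d b)

theorem tensorHom_mul (π : A →ₙₐ[ℂ] Mult C) (σ : B →ₙₐ[ℂ] Mult D) (x y : A ⊗[ℂ] B) :
    tensorHom (π : A →ₗ[ℂ] Mult C) (σ : B →ₗ[ℂ] Mult D) (x * y) =
      tensorHom (π : A →ₗ[ℂ] Mult C) (σ : B →ₗ[ℂ] Mult D) x *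
        tensorHom (π : A →ₗ[ℂ] Mult C) (σ : B →ₗ[ℂ] Mult D) y := by
  induction x with
  | zero => simp
  | add x x' hx hx' => simp only [add_mul, map_add, hx, hx']
  | tmul a b =>
    induction y with
    | zero => simp
    | add y y' hy hy' => simp only [mul_add, map_add, hy, hy']
    | tmul c d =>
      rw [Algebra.TensorProduct.tmul_mul_tmul, tensorHom_tmul, tensorHom_tmul, tensorHom_tmul,
        tmul_mul]
      exact congrArg₂ tmul (map_mul π a c) (map_mul σ b d)

/-- The tensor product of non-degenerate algebras is non-degenerate. -/
theorem isNondegenerateAlg_tensor (hA : IsNondegenerateAlg A) (hB : IsNondegenerateAlg B) :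
    IsNondegenerateAlg (A ⊗[ℂ] B) := by
  classical
  have sep : ∀ x : A ⊗[ℂ] B, (∀ ω : Module.Dual ℂ A, ω.rTensor B x = 0) → x = 0 := by
    intro x hx
    let b := Module.Basis.ofVectorSpace ℂ A
    apply (TensorProduct.equivFinsuppOfBasisLeft (M := A) (N := B) b).injective
    rw [map_zero]
    ext i
    rw [TensorProduct.equivFinsuppOfBasisLeft_apply, hx]
    simp
  constructor
  · intro x hx
    refine sep x fun ω => (TensorProduct.lid ℂ B).injective ?_
    rw [map_zero]
    refine hB.1 _ fun b => (Module.forall_dual_apply_eq_zero_iff ℂ _).1 fun η => ?_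
    have h1 : TensorProduct.rid ℂ A ((η ∘ₗ LinearMap.mulRight ℂ b).lTensor A x) = 0 := by
      refine hA.1 _ fun a => ?_
      have h2 : ∀ y : A ⊗[ℂ] B, TensorProduct.rid ℂ A ((η ∘ₗ LinearMap.mulRight ℂ b).lTensor A y)
          * a = TensorProduct.rid ℂ A (η.lTensor A (y * a ⊗ₜ b)) := by
        intro y
        induction y with
        | zero => simp
        | add y z hy hz => simp only [map_add, add_mul, hy, hz]
        | tmul c d => simp [smul_mul_assoc]
      rw [h2, hx]; simp
    have h3 : ∀ y : A ⊗[ℂ] B, η (TensorProduct.lid ℂ B (ω.rTensor B y) * b) =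
        ω (TensorProduct.rid ℂ A ((η ∘ₗ LinearMap.mulRight ℂ b).lTensor A y)) := by
      intro y
      induction y with
      | zero => simp
      | add y z hy hz => simp only [map_add, add_mul, hy, hz]
      | tmul c d => simp [mul_comm, smul_mul_assoc]
    rw [h3, h1, map_zero]
  · intro x hx
    refine sep x fun ω => (TensorProduct.lid ℂ B).injective ?_
    rw [map_zero]
    refine hB.2 _ fun b => (Module.forall_dual_apply_eq_zero_iff ℂ _).1 fun η => ?_
    have h1 : TensorProduct.rid ℂ A ((η ∘ₗ LinearMap.mulLeft ℂ b).lTensor A x) = 0 := by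
      refine hA.2 _ fun a => ?_
      have h2 : ∀ y : A ⊗[ℂ] B, a * TensorProduct.rid ℂ A ((η ∘ₗ LinearMap.mulLeft ℂ b).lTensor A y)
          = TensorProduct.rid ℂ A (η.lTensor A (a ⊗ₜ b * y)) := by
        intro y
        induction y with
        | zero => simp
        | add y z hy hz => simp only [map_add, mul_add, hy, hz]
        | tmul c d => simp [mul_smul_comm]
      rw [h2, hx]; simp
    have h3 : ∀ y : A ⊗[ℂ] B, η (b * TensorProduct.lid ℂ B (ω.rTensor B y)) =
        ω (TensorProduct.rid ℂ A ((η ∘ₗ LinearMap.mulLeft ℂ b).lTensor A y)) := by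
      intro y
      induction y with
      | zero => simp
      | add y z hy hz => simp only [map_add, mul_add, hy, hz]
      | tmul c d => simp [mul_comm, mul_smul_comm]
    rw [h3, h1, map_zero]

/-- For a non-degenerate homomorphism `π : A → M(C)` and a non-degenerate algebra `B`, the
extension of `π ⊙ ι : A ⊙ B → M(C ⊙ B)` to `M(A ⊙ B)` exists and is unique; it is not assumed
that `B` is spanned by products. -/
theorem existsUnique_extension_tensor_id (hC : IsNondegenerateAlg C) (hB : IsNondegenerateAlg B)
    (π : A →ₙₐ[ℂ] Mult C) (hπ : IsNondegenerateHom π) (m : Mult (A ⊗[ℂ] B)) :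
    ∃! n : Mult (C ⊗[ℂ] B), IsExtensionAt
      (tensorHom (π : A →ₗ[ℂ] Mult C) (incl B : B →ₗ[ℂ] Mult B)) m n := by
  let act : Mult C →ₗ[ℂ] C →ₗ[ℂ] C :=
    LinearMap.mk₂ ℂ (fun m x => m.lmul x) (fun _ _ _ => rfl) (fun _ _ _ => rfl)
      (fun m x y => map_add _ x y) (fun r m x => map_smul _ r x)
  let act' : Mult C →ₗ[ℂ] C →ₗ[ℂ] C :=
    LinearMap.mk₂ ℂ (fun m x => m.rmul x) (fun _ _ _ => rfl) (fun _ _ _ => rfl)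
      (fun m x y => map_add _ x y) (fun r m x => map_smul _ r x)
  let K : (A ⊗[ℂ] B) ⊗[ℂ] C →ₗ[ℂ] C ⊗[ℂ] B :=
    (TensorProduct.lift (act ∘ₗ (π : A →ₗ[ℂ] Mult C))).rTensor B ∘ₗ
      (TensorProduct.rightComm ℂ A B C).toLinearMap
  let K' : (A ⊗[ℂ] B) ⊗[ℂ] C →ₗ[ℂ] C ⊗[ℂ] B :=
    (TensorProduct.lift (act' ∘ₗ (π : A →ₗ[ℂ] Mult C))).rTensor B ∘ₗ
      (TensorProduct.rightComm ℂ A B C).toLinearMap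
  refine existsUnique_isExtensionAt_aux (isNondegenerateAlg_tensor hC hB) _
    (tensorHom_mul π (incl B)) (fun c => tmul (incl C c) 1) K K' ?_ ?_ ?_ ?_ m
  · intro x c
    induction x with
    | zero => simp
    | add x y hx hy => simp only [TensorProduct.add_tmul, map_add, hx, hy, add_mul]
    | tmul a b =>
      have h : K ((a ⊗ₜ b) ⊗ₜ c) = (π a).lmul c ⊗ₜ b := by
        simp [K, act]; rfl
      rw [h, tensorHom_tmul]
      change _ = tmul (π a) (incl B b) * tmul (incl C c) 1
      rw [incl_tmul, tmul_mul, mul_incl, mul_one]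
  · intro x c
    induction x with
    | zero => simp
    | add x y hx hy => simp only [TensorProduct.add_tmul, map_add, hx, hy, mul_add]
    | tmul a b =>
      have h : K' ((a ⊗ₜ b) ⊗ₜ c) = (π a).rmul c ⊗ₜ b := by
        simp [K', act']; rfl
      rw [h, tensorHom_tmul]
      change _ = tmul (incl C c) 1 * tmul (π a) (incl B b)
      rw [incl_tmul, tmul_mul, incl_mul, one_mul]
  · refine (LinearMap.rTensor_surjective B ?_).comp (TensorProduct.rightComm ℂ A B C).surjective
    rw [← LinearMap.range_eq_top, eq_top_iff, ← hπ.1, Submodule.span_le]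
    rintro _ ⟨c, d, rfl⟩
    exact ⟨c ⊗ₜ d, rfl⟩
  · refine (LinearMap.rTensor_surjective B ?_).comp (TensorProduct.rightComm ℂ A B C).surjective
    rw [← LinearMap.range_eq_top, eq_top_iff, ← hπ.2, Submodule.span_le]
    rintro _ ⟨c, d, rfl⟩
    exact ⟨c ⊗ₜ d, rfl⟩

/-- For a non-degenerate homomorphism `π : A → M(C)` and a non-degenerate algebra `B`, the
extension of `ι ⊙ π : B ⊙ A → M(B ⊙ C)` to `M(B ⊙ A)` exists and is unique. -/
theorem existsUnique_extension_id_tensor (hC : IsNondegenerateAlg C) (hB : IsNondegenerateAlg B)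
    (π : A →ₙₐ[ℂ] Mult C) (hπ : IsNondegenerateHom π) (m : Mult (B ⊗[ℂ] A)) :
    ∃! n : Mult (B ⊗[ℂ] C), IsExtensionAt
      (tensorHom (incl B : B →ₗ[ℂ] Mult B) (π : A →ₗ[ℂ] Mult C)) m n := by
  let act : Mult C →ₗ[ℂ] C →ₗ[ℂ] C :=
    LinearMap.mk₂ ℂ (fun m x => m.lmul x) (fun _ _ _ => rfl) (fun _ _ _ => rfl)
      (fun m x y => map_add _ x y) (fun r m x => map_smul _ r x)
  let act' : Mult C →ₗ[ℂ] C →ₗ[ℂ] C :=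
    LinearMap.mk₂ ℂ (fun m x => m.rmul x) (fun _ _ _ => rfl) (fun _ _ _ => rfl)
      (fun m x y => map_add _ x y) (fun r m x => map_smul _ r x)
  let K : (B ⊗[ℂ] A) ⊗[ℂ] C →ₗ[ℂ] B ⊗[ℂ] C :=
    (TensorProduct.lift (act ∘ₗ (π : A →ₗ[ℂ] Mult C))).lTensor B ∘ₗ
      (TensorProduct.assoc ℂ B A C).toLinearMap
  let K' : (B ⊗[ℂ] A) ⊗[ℂ] C →ₗ[ℂ] B ⊗[ℂ] C :=
    (TensorProduct.lift (act' ∘ₗ (π : A →ₗ[ℂ] Mult C))).lTensor B ∘ₗ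
      (TensorProduct.assoc ℂ B A C).toLinearMap
  refine existsUnique_isExtensionAt_aux (isNondegenerateAlg_tensor hB hC) _
    (tensorHom_mul (incl B) π) (fun c => tmul 1 (incl C c)) K K' ?_ ?_ ?_ ?_ m
  · intro x c
    induction x with
    | zero => simp
    | add x y hx hy => simp only [TensorProduct.add_tmul, map_add, hx, hy, add_mul]
    | tmul b a =>
      have h : K ((b ⊗ₜ a) ⊗ₜ c) = b ⊗ₜ (π a).lmul c := by
        simp [K, act]; rfl
      rw [h, tensorHom_tmul]
      change _ = tmul (incl B b) (π a) * tmul 1 (incl C c)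
      rw [incl_tmul, tmul_mul, mul_incl, mul_one]
  · intro x c
    induction x with
    | zero => simp
    | add x y hx hy => simp only [TensorProduct.add_tmul, map_add, hx, hy, mul_add]
    | tmul b a =>
      have h : K' ((b ⊗ₜ a) ⊗ₜ c) = b ⊗ₜ (π a).rmul c := by
        simp [K', act']; rfl
      rw [h, tensorHom_tmul]
      change _ = tmul 1 (incl C c) * tmul (incl B b) (π a)
      rw [incl_tmul, tmul_mul, incl_mul, one_mul]
  · refine (LinearMap.lTensor_surjective B ?_).comp (TensorProduct.assoc ℂ B A C).surjective
    rw [← LinearMap.range_eq_top, eq_top_iff, ← hπ.1, Submodule.span_le]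
    rintro _ ⟨c, d, rfl⟩
    exact ⟨c ⊗ₜ d, rfl⟩
  · refine (LinearMap.lTensor_surjective B ?_).comp (TensorProduct.assoc ℂ B A C).surjective
    rw [← LinearMap.range_eq_top, eq_top_iff, ← hπ.2, Submodule.span_le]
    rintro _ ⟨c, d, rfl⟩
    exact ⟨c ⊗ₜ d, rfl⟩

variable (A B C) in
/-- The isomorphism `A ⊙ (B ⊙ C) ≅ (A ⊙ B) ⊙ C`. -/
def assocEquiv : A ⊗[ℂ] (B ⊗[ℂ] C) ≃ₗ[ℂ] (A ⊗[ℂ] B) ⊗[ℂ] C :=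
  (TensorProduct.assoc ℂ A B C).symm

theorem assocEquiv_mul (x y : A ⊗[ℂ] (B ⊗[ℂ] C)) :
    assocEquiv A B C (x * y) = assocEquiv A B C x * assocEquiv A B C y := by
  have h : (LinearMap.mul ℂ (A ⊗[ℂ] (B ⊗[ℂ] C))).compr₂ (assocEquiv A B C).toLinearMap =
      (LinearMap.mul ℂ ((A ⊗[ℂ] B) ⊗[ℂ] C)).compl₁₂ (assocEquiv A B C).toLinearMap
        (assocEquiv A B C).toLinearMap := by
    ext a b c a' b' c'
    simp [assocEquiv]
  exact congrArg (fun f => f x y) h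

variable (A B C) in
/-- The isomorphism `A ⊙ (B ⊙ C) ≅ (B ⊙ A) ⊙ C` exchanging the first two factors. -/
def leftCommEquiv : A ⊗[ℂ] (B ⊗[ℂ] C) ≃ₗ[ℂ] (B ⊗[ℂ] A) ⊗[ℂ] C :=
  (TensorProduct.leftComm ℂ A B C).trans (TensorProduct.assoc ℂ B A C).symm

theorem leftCommEquiv_mul (x y : A ⊗[ℂ] (B ⊗[ℂ] C)) :
    leftCommEquiv A B C (x * y) = leftCommEquiv A B C x * leftCommEquiv A B C y := by
  have h : (LinearMap.mul ℂ (A ⊗[ℂ] (B ⊗[ℂ] C))).compr₂ (leftCommEquiv A B C).toLinearMap =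
      (LinearMap.mul ℂ ((B ⊗[ℂ] A) ⊗[ℂ] C)).compl₁₂ (leftCommEquiv A B C).toLinearMap
        (leftCommEquiv A B C).toLinearMap := by
    ext a b c a' b' c'
    simp [leftCommEquiv]
  exact congrArg (fun f => f x y) h

/-- `V₂₃ = 1 ⊗ V ∈ M(A ⊙ A ⊙ B)` for `V ∈ M(A ⊙ B)`. -/
def leg23 (V : Mult (A ⊗[ℂ] B)) : Mult ((A ⊗[ℂ] A) ⊗[ℂ] B) :=
  congr (assocEquiv A A B) assocEquiv_mul (tmul 1 V)

/-- `V₁₃ ∈ M(A ⊙ A ⊙ B)` for `V ∈ M(A ⊙ B)`. -/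
def leg13 (V : Mult (A ⊗[ℂ] B)) : Mult ((A ⊗[ℂ] A) ⊗[ℂ] B) :=
  congr (leftCommEquiv A A B) leftCommEquiv_mul (tmul 1 V)

/-- The multiplier `a ⊗ 1` of `A ⊙ B`. -/
def inl (B : Type*) [NonUnitalRing B] [Module ℂ B] [IsScalarTower ℂ B B] [SMulCommClass ℂ B B]
    (a : A) : Mult (A ⊗[ℂ] B) := tmul (incl A a) 1

/-- The multiplier `1 ⊗ b` of `A ⊙ B`. -/
def inr (A : Type*) [NonUnitalRing A] [Module ℂ A] [IsScalarTower ℂ A A] [SMulCommClass ℂ A A]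
    (b : B) : Mult (A ⊗[ℂ] B) := tmul 1 (incl B b)

end Mult

end Multipliers

open Mult

section QuantumGroup

variable {A : Type*} [NonUnitalRing A] [Module ℂ A] [IsScalarTower ℂ A A] [SMulCommClass ℂ A A]
variable {B : Type*} [NonUnitalRing B] [Module ℂ B] [IsScalarTower ℂ B B] [SMulCommClass ℂ B B]

/-- The slice map `ω ⊙ ι : A ⊙ B → B`. -/
def sliceLeft (B : Type*) [NonUnitalRing B] [Module ℂ B] (ω : Module.Dual ℂ A) :
    A ⊗[ℂ] B →ₗ[ℂ] B :=
  (TensorProduct.lid ℂ B).toLinearMap ∘ₗ ω.rTensor B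

/-- The slice map `ι ⊙ ω : A ⊙ B → A`. -/
def sliceRight (A : Type*) [NonUnitalRing A] [Module ℂ A] (ω : Module.Dual ℂ B) :
    A ⊗[ℂ] B →ₗ[ℂ] A :=
  (TensorProduct.rid ℂ A).toLinearMap ∘ₗ ω.lTensor A

/-- A regular multiplier Hopf algebra. The four maps `a ⊗ b ↦ Δ(a)(b ⊗ 1)`, `Δ(a)(1 ⊗ b)`,
`(b ⊗ 1)Δ(a)`, `(1 ⊗ b)Δ(a)` are required to be bijections from `A ⊙ A` onto `A ⊙ A`, the latter
seen inside `M(A ⊙ A)`. -/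
structure IsRegularMultiplierHopf (Δ : A →ₙₐ[ℂ] Mult (A ⊗[ℂ] A)) : Prop where
  nondegenerate : IsNondegenerateAlg A
  comul_nondegenerate : IsNondegenerateHom Δ
  coassoc : ∀ a : A,
    extend (tensorHom (Δ : A →ₗ[ℂ] Mult (A ⊗[ℂ] A)) (incl A : A →ₗ[ℂ] Mult A)) (Δ a) =
      congr (assocEquiv A A A) assocEquiv_mul
        (extend (tensorHom (incl A : A →ₗ[ℂ] Mult A) (Δ : A →ₗ[ℂ] Mult (A ⊗[ℂ] A))) (Δ a))
  bijective₁ : ∃ T : A ⊗[ℂ] A ≃ₗ[ℂ] A ⊗[ℂ] A,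
    ∀ a b, incl (A ⊗[ℂ] A) (T (a ⊗ₜ b)) = Δ a * inl A b
  bijective₂ : ∃ T : A ⊗[ℂ] A ≃ₗ[ℂ] A ⊗[ℂ] A,
    ∀ a b, incl (A ⊗[ℂ] A) (T (a ⊗ₜ b)) = Δ a * inr A b
  bijective₃ : ∃ T : A ⊗[ℂ] A ≃ₗ[ℂ] A ⊗[ℂ] A,
    ∀ a b, incl (A ⊗[ℂ] A) (T (a ⊗ₜ b)) = inl A b * Δ a
  bijective₄ : ∃ T : A ⊗[ℂ] A ≃ₗ[ℂ] A ⊗[ℂ] A,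
    ∀ a b, incl (A ⊗[ℂ] A) (T (a ⊗ₜ b)) = inr A b * Δ a

/-- `(ω ⊙ ι)(W) = m` for `W ∈ M(A ⊙ A)`, `ω ∈ A'`, `m ∈ M(A)`: for all `b`, the elements
`W(1 ⊗ b)` and `(1 ⊗ b)W` lie in `A ⊙ A`, and `m b = (ω ⊙ ι)(W(1 ⊗ b))`,
`b m = (ω ⊙ ι)((1 ⊗ b)W)`. -/
def HasSliceLeft (ω : Module.Dual ℂ A) (W : Mult (A ⊗[ℂ] A)) (m : Mult A) : Prop :=
  ∀ b : A,
    (∃ x, incl (A ⊗[ℂ] A) x = W * inr A b ∧ m.lmul b = sliceLeft A ω x) ∧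
    (∃ x, incl (A ⊗[ℂ] A) x = inr A b * W ∧ m.rmul b = sliceLeft A ω x)

/-- `(ι ⊙ ω)(W) = m`, the mirror image of `HasSliceLeft`. -/
def HasSliceRight (ω : Module.Dual ℂ A) (W : Mult (A ⊗[ℂ] A)) (m : Mult A) : Prop :=
  ∀ b : A,
    (∃ x, incl (A ⊗[ℂ] A) x = W * inl A b ∧ m.lmul b = sliceRight A ω x) ∧
    (∃ x, incl (A ⊗[ℂ] A) x = inl A b * W ∧ m.rmul b = sliceRight A ω x)

/-- A left Haar functional: a non-zero left invariant functional,
`(ι ⊙ φ)Δ(a) = φ(a) 1` for all `a`. -/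
structure IsLeftHaar (Δ : A →ₙₐ[ℂ] Mult (A ⊗[ℂ] A)) (φ : Module.Dual ℂ A) : Prop where
  ne_zero : φ ≠ 0
  left_invariant : ∀ a : A, HasSliceRight φ (Δ a) (φ a • (1 : Mult A))

/-- An algebraic quantum group: a regular multiplier Hopf algebra with a left Haar functional. -/
structure IsAlgebraicQuantumGroup (Δ : A →ₙₐ[ℂ] Mult (A ⊗[ℂ] A)) : Prop where
  regular : IsRegularMultiplierHopf Δ
  exists_haar : ∃ φ : Module.Dual ℂ A, IsLeftHaar Δ φ

/-- The defining property of the counit: a non-zero homomorphism with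
`(ε ⊙ ι)Δ = (ι ⊙ ε)Δ = ι`. -/
structure IsCounit (Δ : A →ₙₐ[ℂ] Mult (A ⊗[ℂ] A)) (ε : A →ₙₐ[ℂ] ℂ) : Prop where
  ne_zero : ε ≠ 0
  left : ∀ a : A, HasSliceLeft (ε : A →ₗ[ℂ] ℂ) (Δ a) (incl A a)
  right : ∀ a : A, HasSliceRight (ε : A →ₗ[ℂ] ℂ) (Δ a) (incl A a)

open Classical in
/-- The counit of a regular multiplier Hopf algebra. -/
def counit (Δ : A →ₙₐ[ℂ] Mult (A ⊗[ℂ] A)) : A →ₙₐ[ℂ] ℂ :=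
  if h : ∃ ε, IsCounit Δ ε then h.choose else 0

/-- The defining property of the antipode: an anti-automorphism `S` of `A` with
`m(S ⊙ ι)(Δ(a)(1 ⊗ b)) = ε(a) b` and `m(ι ⊙ S)((b ⊗ 1)Δ(a)) = ε(a) b`. -/
structure IsAntipode (Δ : A →ₙₐ[ℂ] Mult (A ⊗[ℂ] A)) (S : A ≃ₗ[ℂ] A) : Prop where
  map_mul : ∀ a b, S (a * b) = S b * S a
  left : ∀ a b : A, ∃ x, incl (A ⊗[ℂ] A) x = Δ a * inr A b ∧
    LinearMap.mul' ℂ A (S.toLinearMap.rTensor A x) = counit Δ a • b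
  right : ∀ a b : A, ∃ x, incl (A ⊗[ℂ] A) x = inl A b * Δ a ∧
    LinearMap.mul' ℂ A (S.toLinearMap.lTensor A x) = counit Δ a • b

open Classical in
/-- The antipode of a regular multiplier Hopf algebra. -/
def antipode (Δ : A →ₙₐ[ℂ] Mult (A ⊗[ℂ] A)) : A ≃ₗ[ℂ] A :=
  if h : ∃ S, IsAntipode Δ S then h.choose else LinearEquiv.refl ℂ A

/-- The space `Â = {φ a | a ∈ A}` of functionals `(φ a)(x) = φ(a x)`. -/
def dualSpace (φ : Module.Dual ℂ A) : Submodule ℂ (Module.Dual ℂ A) :=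
  LinearMap.range ((LinearMap.mul ℂ A).compr₂ φ)

/-- The functional `a θ`, `(a θ)(x) = θ(x a)`. -/
def lact (a : A) (θ : Module.Dual ℂ A) : Module.Dual ℂ A := θ ∘ₗ LinearMap.mulRight ℂ a

/-- A corepresentation of `(A, Δ)` on `B`: an element `V ∈ M(A ⊙ B)` with
`(Δ ⊙ ι)(V) = V₁₃ V₂₃` in `M(A ⊙ A ⊙ B)`. -/
def IsCorepresentation (Δ : A →ₙₐ[ℂ] Mult (A ⊗[ℂ] A)) (V : Mult (A ⊗[ℂ] B)) : Prop :=
  extend (tensorHom (Δ : A →ₗ[ℂ] Mult (A ⊗[ℂ] A)) (incl B : B →ₗ[ℂ] Mult B)) V =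
    leg13 V * leg23 V

/-- `(ω ⊙ ι)(V) = m ∈ M(B)` for `V ∈ M(A ⊙ B)` and a functional `ω` of the form `a θ`:
`m x = (θ ⊙ ι)(V(a ⊗ x))` for every such way of writing `ω`. -/
def IsSlice (V : Mult (A ⊗[ℂ] B)) (ω : Module.Dual ℂ A) (m : Mult B) : Prop :=
  (∃ (a : A) (θ : Module.Dual ℂ A), ω = lact a θ) ∧
  ∀ (a : A) (θ : Module.Dual ℂ A), ω = lact a θ →
    ∀ x : B, m.lmul x = sliceLeft B θ (V.lmul (a ⊗ₜ x))

open Classical in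
/-- The slice `(ω ⊙ ι)(V) ∈ M(B)`. -/
def slice (V : Mult (A ⊗[ℂ] B)) (ω : Module.Dual ℂ A) : Mult B :=
  if h : ∃ m, IsSlice V ω m then h.choose else 0

/-- The map `π_V : Â → M(B)`, `π_V(ω) = (ω ⊙ ι)(V)`. -/
def corepMap (φ : Module.Dual ℂ A) (V : Mult (A ⊗[ℂ] B)) (ω : dualSpace φ) : Mult B :=
  slice V ω.1

/-- The defining property of `W = (S ⊙ ι)(V)`: for all `a`, `b`, the elements
`(S⁻¹(a) ⊗ 1)V(1 ⊗ b)` and `(1 ⊗ b)V(S⁻¹(a) ⊗ 1)` lie in `A ⊙ B`, and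
`W(a ⊗ b) = (S ⊙ ι)((S⁻¹(a) ⊗ 1)V(1 ⊗ b))`, `(a ⊗ b)W = (S ⊙ ι)((1 ⊗ b)V(S⁻¹(a) ⊗ 1))`. -/
def IsAntipodeTensorId (S : A ≃ₗ[ℂ] A) (V W : Mult (A ⊗[ℂ] B)) : Prop :=
  ∀ (a : A) (b : B),
    (∃ x, incl (A ⊗[ℂ] B) x = inl B (S.symm a) * V * inr A b ∧
      W.lmul (a ⊗ₜ b) = S.toLinearMap.rTensor B x) ∧
    (∃ x, incl (A ⊗[ℂ] B) x = inr A b * V * inl B (S.symm a) ∧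
      W.rmul (a ⊗ₜ b) = S.toLinearMap.rTensor B x)

open Classical in
/-- The element `(S ⊙ ι)(V) ∈ M(A ⊙ B)`. -/
def antipodeTensorId (S : A ≃ₗ[ℂ] A) (V : Mult (A ⊗[ℂ] B)) : Mult (A ⊗[ℂ] B) :=
  if h : ∃ W, IsAntipodeTensorId S V W then h.choose else 0

end QuantumGroup

end AlgQuantumGroup

end

open scoped TensorProduct

noncomputable section

namespace AlgQuantumGroup

set_option linter.unusedSectionVars false

open Mult

/-! ### Calculus in multiplier algebras of tensor products -/

section MultiplierLemmas

variable {A : Type*} [NonUnitalRing A] [Module ℂ A] [IsScalarTower ℂ A A] [SMulCommClass ℂ A A]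
variable {B : Type*} [NonUnitalRing B] [Module ℂ B] [IsScalarTower ℂ B B] [SMulCommClass ℂ B B]
variable {C : Type*} [NonUnitalRing C] [Module ℂ C] [IsScalarTower ℂ C C] [SMulCommClass ℂ C C]
variable {D : Type*} [NonUnitalRing D] [Module ℂ D] [IsScalarTower ℂ D D] [SMulCommClass ℂ D D]

namespace Mult

/-! Write g(y) = (φ ⊙ ι)(V(y ⊗ b)). Slicing the middle leg of (Δ ⊙ ι)(V) = V₁₃V₂₃ with φ, after
multiplying by Δ(p)(q ⊗ 1) ⊗ b, left invariance collapses one side and gives V · (ι ⊙ g)(Δ(p)(q ⊗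
1)) = q ⊗ g(p) (`lmul_sliceMap_t₃`). Hence V⁻¹(a ⊗ g(c)) = (ι ⊙ g)(Δ(c)(a ⊗ 1)). Invertibility of V
makes the elements g(c), with b varying, span B, so this formula determines V⁻¹. The element (S⁻¹(a)
⊗ 1)V(1 ⊗ g(c)) is then (S⁻¹ ⊙ g)(Δ(c)(a ⊗ 1)), by the Hopf identity S(p₁q)p₂d ⊗ p₃ = S(q)d ⊗ p
(`antipodeMul_t₃`). This gives the left half of (S ⊙ ι)(V) = V⁻¹; the right half follows from the
compatibility of the two actions of V⁻¹.

For the second part, the Haar functional satisfies {φ(b ·)} = {φ(S(· c))}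
(`exists_haar_antipode_eq`, `exists_haar_eq_antipode`). So Â is stable under Ŝ, and each ω in Â has
both a form η(c ·) and a form θ(· a). The two forms define the right and the left action of the
slice, and local units of A make them compatible (`mul_sliceLeft_eq`). The slice formula is then the
first part with θ ∘ S applied to the first leg.

The counit and the antipode are introduced by choice from their characterizing properties, so their
existence is part of the proof. It follows Van Daele: ε is read off from multiplication after T₁⁻¹,
and S from (ε ⊙ ι)T₁⁻¹T₃. Every Sweedler-type computation is carried out with the Galois maps, whose
values lie in A ⊙ A, so that no leg is left uncovered. -/

@[simp] theorem inl_lmul_tmul (x a : A) (b : B) : (inl B x).lmul (a ⊗ₜ b) = (x * a) ⊗ₜ b := rfl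

@[simp] theorem inl_rmul_tmul (x a : A) (b : B) : (inl B x).rmul (a ⊗ₜ b) = (a * x) ⊗ₜ b := rfl

@[simp] theorem inr_lmul_tmul (y : B) (a : A) (b : B) :
    (inr A y).lmul (a ⊗ₜ b) = a ⊗ₜ (y * b) := rfl

@[simp] theorem inr_rmul_tmul (y : B) (a : A) (b : B) :
    (inr A y).rmul (a ⊗ₜ b) = a ⊗ₜ (b * y) := rfl

@[simp] theorem one_lmul (a : A) : (1 : Mult A).lmul a = a := rfl

/-- The right action is recovered from the left one through (x m) b = x (m b) and non-degeneracy. -/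
theorem ext_lmul (hD : IsNondegenerateAlg D) {m n : Mult D} (h : ∀ x, m.lmul x = n.lmul x) :
    m = n :=
  ext h fun x => sub_eq_zero.1 (hD.1 _ fun b => by
    rw [sub_mul, rmul_mul, rmul_mul, h, sub_self])

theorem ext_rmul (hD : IsNondegenerateAlg D) {m n : Mult D} (h : ∀ x, m.rmul x = n.rmul x) :
    m = n :=
  ext (fun x => sub_eq_zero.1 (hD.2 _ fun b => by
    rw [mul_sub, ← rmul_mul, ← rmul_mul, h, sub_self])) h

theorem inl_mul_inr (a : A) (b : B) : inl B a * inr A b = incl (A ⊗[ℂ] B) (a ⊗ₜ b) := by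
  rw [inl, inr, tmul_mul, mul_one, one_mul, incl_tmul]

theorem inr_mul_inl (a : A) (b : B) : inr A b * inl B a = incl (A ⊗[ℂ] B) (a ⊗ₜ b) := by
  rw [inl, inr, tmul_mul, mul_one, one_mul, incl_tmul]

theorem commute_inl_inr (a : A) (b : B) : inl B a * inr A b = inr A b * inl B a := by
  rw [inl_mul_inr, inr_mul_inl]

theorem inr_mul (b b' : B) : inr A (b * b') = inr A b * inr A b' := by
  rw [inr, inr, inr, tmul_mul, map_mul, one_mul]

theorem congr_mul (e : C ≃ₗ[ℂ] D) (he : ∀ x y, e (x * y) = e x * e y) (m n : Mult C) :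
    congr e he (m * n) = congr e he m * congr e he n := by
  refine ext (fun x => ?_) (fun x => ?_)
  · change e (m.lmul (n.lmul (e.symm x))) = e (m.lmul (e.symm (e (n.lmul (e.symm x)))))
    rw [e.symm_apply_apply]
  · change e (n.rmul (m.rmul (e.symm x))) = e (n.rmul (e.symm (e (m.rmul (e.symm x)))))
    rw [e.symm_apply_apply]

theorem congr_incl (e : C ≃ₗ[ℂ] D) (he : ∀ x y, e (x * y) = e x * e y) (c : C) :
    congr e he (incl C c) = incl D (e c) := by
  refine ext (fun x => ?_) (fun x => ?_)
  · change e (c * e.symm x) = e c * x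
    rw [he, e.apply_symm_apply]
  · change e (e.symm x * c) = x * e c
    rw [he, e.apply_symm_apply]

theorem congr_assoc_tmul (m : Mult A) (n : Mult B) (k : Mult C) :
    congr (assocEquiv A B C) assocEquiv_mul (tmul m (tmul n k)) = tmul (tmul m n) k := by
  refine ext (fun x => ?_) (fun x => ?_)
  · induction x with
    | zero => simp
    | add x y hx hy => simp only [map_add, hx, hy]
    | tmul x c =>
      induction x with
      | zero => simp
      | add x y hx hy => simp only [TensorProduct.add_tmul, map_add, hx, hy]
      | tmul a b => rfl
  · induction x with
    | zero => simp
    | add x y hx hy => simp only [map_add, hx, hy]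
    | tmul x c =>
      induction x with
      | zero => simp
      | add x y hx hy => simp only [TensorProduct.add_tmul, map_add, hx, hy]
      | tmul a b => rfl

/-- Non-degeneracy of π makes the elements π(c)d' ⊗ b span D ⊙ B, and each factors as (π(c) ⊗ b)(d'
⊗ 1). Only the first leg is factored, so B need not be spanned by products. -/
theorem tensorHom_tensor_incl_cancel (hD : IsNondegenerateAlg D) (hB : IsNondegenerateAlg B)
    (π : A →ₙₐ[ℂ] Mult D) (hπ : IsNondegenerateHom π) {m n : Mult (D ⊗[ℂ] B)}
    (h : ∀ x, m * tensorHom (π : A →ₗ[ℂ] Mult D) (incl B : B →ₗ[ℂ] Mult B) x =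
      n * tensorHom (π : A →ₗ[ℂ] Mult D) (incl B : B →ₗ[ℂ] Mult B) x) : m = n := by
  refine ext_lmul (isNondegenerateAlg_tensor hD hB) fun x => ?_
  induction x with
  | zero => simp
  | add x y hx hy => simp only [map_add, hx, hy]
  | tmul d b =>
    have hd : d ∈ Submodule.span ℂ {d : D | ∃ c d', d = (π c).lmul d'} := hπ.1 ▸ trivial
    induction hd using Submodule.span_induction with
    | zero => simp
    | add x y _ _ hx hy => simp only [TensorProduct.add_tmul, map_add, hx, hy]
    | smul r x _ hx => simp only [← TensorProduct.smul_tmul', map_smul, hx]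
    | mem x hx =>
      obtain ⟨c, d', rfl⟩ := hx
      apply incl_injective (isNondegenerateAlg_tensor hD hB)
      have key : incl (D ⊗[ℂ] B) ((π c).lmul d' ⊗ₜ b) =
          tensorHom (π : A →ₗ[ℂ] Mult D) (incl B : B →ₗ[ℂ] Mult B) (c ⊗ₜ b) *
            tmul (incl D d') 1 := by
        rw [tensorHom_tmul]
        change _ = tmul (π c) (incl B b) * _
        rw [tmul_mul, mul_incl, mul_one, incl_tmul]
      rw [← mul_incl, ← mul_incl, key, ← mul_assoc, ← mul_assoc, h]

theorem tensorHom_incl_tensor_cancel (hD : IsNondegenerateAlg D) (hB : IsNondegenerateAlg B)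
    (π : A →ₙₐ[ℂ] Mult D) (hπ : IsNondegenerateHom π) {m n : Mult (B ⊗[ℂ] D)}
    (h : ∀ x, m * tensorHom (incl B : B →ₗ[ℂ] Mult B) (π : A →ₗ[ℂ] Mult D) x =
      n * tensorHom (incl B : B →ₗ[ℂ] Mult B) (π : A →ₗ[ℂ] Mult D) x) : m = n := by
  refine ext_lmul (isNondegenerateAlg_tensor hB hD) fun x => ?_
  induction x with
  | zero => simp
  | add x y hx hy => simp only [map_add, hx, hy]
  | tmul b d =>
    have hd : d ∈ Submodule.span ℂ {d : D | ∃ c d', d = (π c).lmul d'} := hπ.1 ▸ trivial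
    induction hd using Submodule.span_induction with
    | zero => simp
    | add x y _ _ hx hy => simp only [TensorProduct.tmul_add, map_add, hx, hy]
    | smul r x _ hx => simp only [TensorProduct.tmul_smul, map_smul, hx]
    | mem x hx =>
      obtain ⟨c, d', rfl⟩ := hx
      apply incl_injective (isNondegenerateAlg_tensor hB hD)
      have key : incl (B ⊗[ℂ] D) (b ⊗ₜ (π c).lmul d') =
          tensorHom (incl B : B →ₗ[ℂ] Mult B) (π : A →ₗ[ℂ] Mult D) (b ⊗ₜ c) *
            tmul 1 (incl D d') := by
        rw [tensorHom_tmul]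
        change _ = tmul (incl B b) (π c) * _
        rw [tmul_mul, mul_incl, mul_one, incl_tmul]
      rw [← mul_incl, ← mul_incl, key, ← mul_assoc, ← mul_assoc, h]

theorem tensorHom_incl_tensor_cancel' (hD : IsNondegenerateAlg D) (hB : IsNondegenerateAlg B)
    (π : A →ₙₐ[ℂ] Mult D) (hπ : IsNondegenerateHom π) {m n : Mult (B ⊗[ℂ] D)}
    (h : ∀ x, tensorHom (incl B : B →ₗ[ℂ] Mult B) (π : A →ₗ[ℂ] Mult D) x * m =
      tensorHom (incl B : B →ₗ[ℂ] Mult B) (π : A →ₗ[ℂ] Mult D) x * n) : m = n := by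
  refine ext_rmul (isNondegenerateAlg_tensor hB hD) fun x => ?_
  induction x with
  | zero => simp
  | add x y hx hy => simp only [map_add, hx, hy]
  | tmul b d =>
    have hd : d ∈ Submodule.span ℂ {d : D | ∃ c d', d = (π c).rmul d'} := hπ.2 ▸ trivial
    induction hd using Submodule.span_induction with
    | zero => simp
    | add x y _ _ hx hy => simp only [TensorProduct.tmul_add, map_add, hx, hy]
    | smul r x _ hx => simp only [TensorProduct.tmul_smul, map_smul, hx]
    | mem x hx =>
      obtain ⟨c, d', rfl⟩ := hx
      apply incl_injective (isNondegenerateAlg_tensor hB hD)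
      have key : incl (B ⊗[ℂ] D) (b ⊗ₜ (π c).rmul d') =
          tmul 1 (incl D d') *
            tensorHom (incl B : B →ₗ[ℂ] Mult B) (π : A →ₗ[ℂ] Mult D) (b ⊗ₜ c) := by
        rw [tensorHom_tmul]
        change _ = _ * tmul (incl B b) (π c)
        rw [tmul_mul, incl_mul, one_mul, incl_tmul]
      rw [← incl_mul, ← incl_mul, key, mul_assoc, mul_assoc, h]

end Mult

end MultiplierLemmas

/-! ### The four Galois maps -/

section Galois

variable {A : Type*} [NonUnitalRing A] [Module ℂ A] [IsScalarTower ℂ A A] [SMulCommClass ℂ A A]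

/-- The four Galois maps `a ⊗ b ↦ Δ(a)(1 ⊗ b)`, `(b ⊗ 1)Δ(a)`, `Δ(a)(b ⊗ 1)`, `(1 ⊗ b)Δ(a)` of a
comultiplication. -/
structure IsGaloisMaps (Δ : A →ₙₐ[ℂ] Mult (A ⊗[ℂ] A))
    (T₁ T₂ T₃ T₄ : A ⊗[ℂ] A ≃ₗ[ℂ] A ⊗[ℂ] A) : Prop where
  regular : IsRegularMultiplierHopf Δ
  t₁ : ∀ a b, incl (A ⊗[ℂ] A) (T₁ (a ⊗ₜ b)) = Δ a * inr A b
  t₂ : ∀ a b, incl (A ⊗[ℂ] A) (T₂ (a ⊗ₜ b)) = inl A b * Δ a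
  t₃ : ∀ a b, incl (A ⊗[ℂ] A) (T₃ (a ⊗ₜ b)) = Δ a * inl A b
  t₄ : ∀ a b, incl (A ⊗[ℂ] A) (T₄ (a ⊗ₜ b)) = inr A b * Δ a

theorem IsRegularMultiplierHopf.exists_galoisMaps {Δ : A →ₙₐ[ℂ] Mult (A ⊗[ℂ] A)}
    (h : IsRegularMultiplierHopf Δ) : ∃ T₁ T₂ T₃ T₄, IsGaloisMaps Δ T₁ T₂ T₃ T₄ := by
  obtain ⟨T₃, h₃⟩ := h.bijective₁
  obtain ⟨T₁, h₁⟩ := h.bijective₂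
  obtain ⟨T₂, h₂⟩ := h.bijective₃
  obtain ⟨T₄, h₄⟩ := h.bijective₄
  exact ⟨T₁, T₂, T₃, T₄, h, h₁, h₂, h₃, h₄⟩

/-- The map `a ↦ T(a ⊗ b)`. -/
def fixRight (T : A ⊗[ℂ] A ≃ₗ[ℂ] A ⊗[ℂ] A) (b : A) : A →ₗ[ℂ] A ⊗[ℂ] A :=
  T.toLinearMap ∘ₗ (TensorProduct.mk ℂ A A).flip b

@[simp] theorem fixRight_apply (T : A ⊗[ℂ] A ≃ₗ[ℂ] A ⊗[ℂ] A) (a b : A) :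
    fixRight T b a = T (a ⊗ₜ b) := rfl

namespace IsGaloisMaps

variable {Δ : A →ₙₐ[ℂ] Mult (A ⊗[ℂ] A)} {T₁ T₂ T₃ T₄ : A ⊗[ℂ] A ≃ₗ[ℂ] A ⊗[ℂ] A}
  (h : IsGaloisMaps Δ T₁ T₂ T₃ T₄)

include h

theorem nondeg : IsNondegenerateAlg A := h.regular.nondegenerate

theorem nondeg₂ : IsNondegenerateAlg (A ⊗[ℂ] A) := isNondegenerateAlg_tensor h.nondeg h.nondeg

theorem inj : Function.Injective (incl (A ⊗[ℂ] A)) := incl_injective h.nondeg₂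

end IsGaloisMaps

end Galois

/-! ### Coassociativity expressed inside tensor powers of A -/

section Coassociativity

variable {A : Type*} [NonUnitalRing A] [Module ℂ A] [IsScalarTower ℂ A A] [SMulCommClass ℂ A A]
variable {B : Type*} [NonUnitalRing B] [Module ℂ B] [IsScalarTower ℂ B B] [SMulCommClass ℂ B B]

namespace Mult

theorem tmul_one_one : tmul (1 : Mult A) (1 : Mult B) = 1 :=
  ext (fun x => LinearMap.congr_fun TensorProduct.map_id x)
    (fun x => LinearMap.congr_fun TensorProduct.map_id x)

/-- Covers one leg of an extended multiplier: if r plays the role of σ(R) and m R already lies in C,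
the extension of σ at m times r is an honest value of σ. This is how (Δ ⊙ ι)(Δ(a)) becomes
computable after multiplication by an elementary multiplier. -/
theorem extension_mul {C D : Type*}
    [NonUnitalRing C] [Module ℂ C] [IsScalarTower ℂ C C] [SMulCommClass ℂ C C]
    [NonUnitalRing D] [Module ℂ D] [IsScalarTower ℂ D D] [SMulCommClass ℂ D D]
    (σ : C →ₗ[ℂ] Mult D) (hσ : ∀ x y, σ (x * y) = σ x * σ y)
    (cancel : ∀ m n : Mult D, (∀ x, m * σ x = n * σ x) → m = n)
    {m R : Mult C} {E r : Mult D} (hE : IsExtensionAt σ m E) (hr : ∀ x, r * σ x = σ (R.lmul x))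
    {t : C} (ht : incl C t = m * R) : E * r = σ t := by
  refine cancel _ _ fun x => ?_
  rw [mul_assoc, hr, (hE _).1, ← hσ]
  exact congrArg (fun k => σ (k.lmul x)) ht.symm

theorem mul_extension {C D : Type*}
    [NonUnitalRing C] [Module ℂ C] [IsScalarTower ℂ C C] [SMulCommClass ℂ C C]
    [NonUnitalRing D] [Module ℂ D] [IsScalarTower ℂ D D] [SMulCommClass ℂ D D]
    (σ : C →ₗ[ℂ] Mult D) (hσ : ∀ x y, σ (x * y) = σ x * σ y)
    (cancel : ∀ m n : Mult D, (∀ x, σ x * m = σ x * n) → m = n)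
    {m R : Mult C} {E r : Mult D} (hE : IsExtensionAt σ m E) (hr : ∀ x, σ x * r = σ (R.rmul x))
    {t : C} (ht : incl C t = R * m) : r * E = σ t := by
  refine cancel _ _ fun x => ?_
  rw [← mul_assoc, hr, (hE _).2, ← hσ]
  exact congrArg (fun k => σ (k.rmul x)) ht.symm

theorem tensorHom_left_mul_of {C : Type*}
    [NonUnitalRing C] [Module ℂ C] [IsScalarTower ℂ C C] [SMulCommClass ℂ C C]
    (π : A →ₗ[ℂ] Mult C) (r : Mult C) (f : A →ₗ[ℂ] C) (hf : ∀ a, incl C (f a) = π a * r)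
    (x : A ⊗[ℂ] B) :
    tensorHom π (incl B : B →ₗ[ℂ] Mult B) x * tmul r 1 = incl (C ⊗[ℂ] B) (f.rTensor B x) := by
  induction x with
  | zero => simp
  | add x y hx hy => simp only [map_add, add_mul, hx, hy]
  | tmul a b =>
    rw [tensorHom_tmul, LinearMap.rTensor_tmul, incl_tmul, hf, tmul_mul, mul_one]
    rfl

theorem mul_tensorHom_left_of {C : Type*}
    [NonUnitalRing C] [Module ℂ C] [IsScalarTower ℂ C C] [SMulCommClass ℂ C C]
    (π : A →ₗ[ℂ] Mult C) (r : Mult C) (f : A →ₗ[ℂ] C) (hf : ∀ a, incl C (f a) = r * π a)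
    (x : A ⊗[ℂ] B) :
    tmul r 1 * tensorHom π (incl B : B →ₗ[ℂ] Mult B) x = incl (C ⊗[ℂ] B) (f.rTensor B x) := by
  induction x with
  | zero => simp
  | add x y hx hy => simp only [map_add, mul_add, hx, hy]
  | tmul a b =>
    rw [tensorHom_tmul, LinearMap.rTensor_tmul, incl_tmul, hf, tmul_mul, one_mul]
    rfl

theorem tensorHom_right_mul_of {C : Type*}
    [NonUnitalRing C] [Module ℂ C] [IsScalarTower ℂ C C] [SMulCommClass ℂ C C]
    (π : A →ₗ[ℂ] Mult C) (r : Mult C) (f : A →ₗ[ℂ] C) (hf : ∀ a, incl C (f a) = π a * r)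
    (x : B ⊗[ℂ] A) :
    tensorHom (incl B : B →ₗ[ℂ] Mult B) π x * tmul 1 r = incl (B ⊗[ℂ] C) (f.lTensor B x) := by
  induction x with
  | zero => simp
  | add x y hx hy => simp only [map_add, add_mul, hx, hy]
  | tmul b a =>
    rw [tensorHom_tmul, LinearMap.lTensor_tmul, incl_tmul, hf, tmul_mul, mul_one]
    rfl

section TensorHomProducts

variable {C : Type*} [NonUnitalRing C] [Module ℂ C] [IsScalarTower ℂ C C] [SMulCommClass ℂ C C]
variable {D : Type*} [NonUnitalRing D] [Module ℂ D] [IsScalarTower ℂ D D] [SMulCommClass ℂ D D]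

theorem tmul_one_mul_tensorHom (π : A →ₗ[ℂ] Mult C) (σ : B →ₗ[ℂ] Mult D) (b : B) (r : Mult D)
    (hr : ∀ b', r * σ b' = σ (b * b')) (x : A ⊗[ℂ] B) :
    tmul 1 r * tensorHom π σ x = tensorHom π σ ((inr A b).lmul x) := by
  induction x with
  | zero => simp
  | add x y hx hy => simp only [map_add, mul_add, hx, hy]
  | tmul a c => rw [inr_lmul_tmul, tensorHom_tmul, tensorHom_tmul, tmul_mul, one_mul, hr]

theorem tmul_mul_tensorHom (π : A →ₗ[ℂ] Mult C) (σ : B →ₗ[ℂ] Mult D) (a : A) (r : Mult C)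
    (hr : ∀ a', r * π a' = π (a * a')) (x : A ⊗[ℂ] B) :
    tmul r 1 * tensorHom π σ x = tensorHom π σ ((inl B a).lmul x) := by
  induction x with
  | zero => simp
  | add x y hx hy => simp only [map_add, mul_add, hx, hy]
  | tmul a c => rw [inl_lmul_tmul, tensorHom_tmul, tensorHom_tmul, tmul_mul, one_mul, hr]

theorem tensorHom_mul_tmul_one (π : A →ₗ[ℂ] Mult C) (σ : B →ₗ[ℂ] Mult D) (a : A) (r : Mult C)
    (hr : ∀ a', π a' * r = π (a' * a)) (x : A ⊗[ℂ] B) :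
    tensorHom π σ x * tmul r 1 = tensorHom π σ ((inl B a).rmul x) := by
  induction x with
  | zero => simp
  | add x y hx hy => simp only [map_add, add_mul, hx, hy]
  | tmul a c => rw [inl_rmul_tmul, tensorHom_tmul, tensorHom_tmul, tmul_mul, mul_one, hr]

theorem congr_assoc_incl (x : A ⊗[ℂ] (B ⊗[ℂ] C)) :
    congr (assocEquiv A B C) assocEquiv_mul (incl (A ⊗[ℂ] (B ⊗[ℂ] C)) x) =
      incl ((A ⊗[ℂ] B) ⊗[ℂ] C) (assocEquiv A B C x) := congr_incl _ _ _

theorem congr_assoc_mul (m n : Mult (A ⊗[ℂ] (B ⊗[ℂ] C))) :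
    (congr (assocEquiv A B C) assocEquiv_mul (m * n) : Mult ((A ⊗[ℂ] B) ⊗[ℂ] C)) =
      (congr (assocEquiv A B C) assocEquiv_mul m : Mult ((A ⊗[ℂ] B) ⊗[ℂ] C)) *
        (congr (assocEquiv A B C) assocEquiv_mul n : Mult ((A ⊗[ℂ] B) ⊗[ℂ] C)) :=
  congr_mul _ _ _ _

theorem congr_assoc_tmul_one (m : Mult A) :
    congr (assocEquiv A B C) assocEquiv_mul (tmul m 1) = tmul (tmul m 1) 1 := by
  rw [← tmul_one_one, congr_assoc_tmul]

theorem congr_injective (e : C ≃ₗ[ℂ] D) (he : ∀ x y, e (x * y) = e x * e y) :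
    Function.Injective (congr e he) := by
  intro m n hmn
  refine ext (fun x => e.injective ?_) (fun x => e.injective ?_)
  · have h' : e (m.lmul (e.symm (e x))) = e (n.lmul (e.symm (e x))) :=
      congrArg (fun t => t.lmul (e x)) hmn
    rwa [e.symm_apply_apply] at h'
  · have h' : e (m.rmul (e.symm (e x))) = e (n.rmul (e.symm (e x))) :=
      congrArg (fun t => t.rmul (e x)) hmn
    rwa [e.symm_apply_apply] at h'

theorem congr_assoc_injective : Function.Injective fun m : Mult (A ⊗[ℂ] (B ⊗[ℂ] C)) =>
    (congr (assocEquiv A B C) assocEquiv_mul m : Mult ((A ⊗[ℂ] B) ⊗[ℂ] C)) :=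
  congr_injective _ _

end TensorHomProducts

end Mult

/-- The map `s ↦ Δ(s) z`. -/
def comulMulRight (Δ : A →ₙₐ[ℂ] Mult (A ⊗[ℂ] A)) (z : A ⊗[ℂ] A) : A →ₗ[ℂ] A ⊗[ℂ] A where
  toFun s := (Δ s).lmul z
  map_add' s t := by rw [map_add]; rfl
  map_smul' r s := by rw [map_smul]; rfl

/-- The map `c ⊗ d ↦ (Δ ⊙ ι)(Δ(a)(1 ⊗ d))(1 ⊗ c ⊗ 1)`. -/
def doubleComulMul (T : A ⊗[ℂ] A ≃ₗ[ℂ] A ⊗[ℂ] A) (a : A) :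
    A ⊗[ℂ] A →ₗ[ℂ] A ⊗[ℂ] (A ⊗[ℂ] A) :=
  TensorProduct.lift (LinearMap.mk₂ ℂ
    (fun c d => TensorProduct.assoc ℂ A A A ((fixRight T c).rTensor A (T (a ⊗ₜ d))))
    (fun c c' d => by
      have : fixRight T (c + c') = fixRight T c + fixRight T c' := by
        ext; simp [TensorProduct.tmul_add]
      rw [this, LinearMap.rTensor_add, LinearMap.add_apply, map_add])
    (fun r c d => by
      have : fixRight T (r • c) = r • fixRight T c := by
        ext; simp
      rw [this, LinearMap.rTensor_smul, LinearMap.smul_apply, map_smul])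
    (fun c d d' => by simp only [TensorProduct.tmul_add, map_add])
    (fun r c d => by simp only [TensorProduct.tmul_smul, map_smul]))

@[simp] theorem doubleComulMul_tmul (T : A ⊗[ℂ] A ≃ₗ[ℂ] A ⊗[ℂ] A) (a c d : A) :
    doubleComulMul T a (c ⊗ₜ d) =
      TensorProduct.assoc ℂ A A A ((fixRight T c).rTensor A (T (a ⊗ₜ d))) := by
  simp [doubleComulMul]

namespace IsGaloisMaps

variable {Δ : A →ₙₐ[ℂ] Mult (A ⊗[ℂ] A)} {T₁ T₂ T₃ T₄ : A ⊗[ℂ] A ≃ₗ[ℂ] A ⊗[ℂ] A}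
  (h : IsGaloisMaps Δ T₁ T₂ T₃ T₄)

include h

theorem inj₃ : Function.Injective (incl ((A ⊗[ℂ] A) ⊗[ℂ] A)) :=
  incl_injective (isNondegenerateAlg_tensor h.nondeg₂ h.nondeg)

theorem extend_comul_id (a : A) :
    IsExtensionAt (tensorHom (Δ : A →ₗ[ℂ] Mult (A ⊗[ℂ] A)) (incl A : A →ₗ[ℂ] Mult A)) (Δ a)
      (extend (tensorHom (Δ : A →ₗ[ℂ] Mult (A ⊗[ℂ] A)) (incl A : A →ₗ[ℂ] Mult A)) (Δ a)) := by
  have hex := (existsUnique_extension_tensor_id h.nondeg₂ h.nondeg Δ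
    h.regular.comul_nondegenerate (Δ a)).exists
  rw [extend, dif_pos hex]
  exact hex.choose_spec

theorem extend_id_comul (a : A) :
    IsExtensionAt (tensorHom (incl A : A →ₗ[ℂ] Mult A) (Δ : A →ₗ[ℂ] Mult (A ⊗[ℂ] A))) (Δ a)
      (extend (tensorHom (incl A : A →ₗ[ℂ] Mult A) (Δ : A →ₗ[ℂ] Mult (A ⊗[ℂ] A))) (Δ a)) := by
  have hex := (existsUnique_extension_id_tensor h.nondeg₂ h.nondeg Δ
    h.regular.comul_nondegenerate (Δ a)).exists
  rw [extend, dif_pos hex]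
  exact hex.choose_spec

/-- The iterated comultiplication of `a`, as a multiplier of `A ⊙ (A ⊙ A)`, with its products
by elementary multipliers. -/
theorem exists_iterated_comul (a : A) :
    ∃ E : Mult (A ⊗[ℂ] (A ⊗[ℂ] A)),
      (∀ d, congr (assocEquiv A A A) assocEquiv_mul E * tmul 1 (incl A d) =
        tensorHom (Δ : A →ₗ[ℂ] Mult (A ⊗[ℂ] A)) (incl A : A →ₗ[ℂ] Mult A) (T₁ (a ⊗ₜ d))) ∧
      (∀ d, tmul (incl A d) 1 * E =
        tensorHom (incl A : A →ₗ[ℂ] Mult A) (Δ : A →ₗ[ℂ] Mult (A ⊗[ℂ] A)) (T₂ (a ⊗ₜ d))) ∧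
      (∀ d, E * tmul (incl A d) 1 =
        tensorHom (incl A : A →ₗ[ℂ] Mult A) (Δ : A →ₗ[ℂ] Mult (A ⊗[ℂ] A)) (T₃ (a ⊗ₜ d))) ∧
      (∀ b, E * tmul 1 (Δ b) =
        tensorHom (incl A : A →ₗ[ℂ] Mult A) (Δ : A →ₗ[ℂ] Mult (A ⊗[ℂ] A)) (T₁ (a ⊗ₜ b))) := by
  have hA := h.nondeg
  have hD := h.nondeg₂
  have hΔ := h.regular.comul_nondegenerate
  have e₁ := h.extend_comul_id a
  have e₂ := h.extend_id_comul a
  -- Coassociativity lets a single multiplier E = (ι ⊙ Δ)(Δ(a)) serve for both iterated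
  -- comultiplications, up to reassociation.
  rw [h.regular.coassoc a] at e₁
  exact ⟨_,
    fun d => extension_mul _ (tensorHom_mul Δ (incl A))
      (fun m n => tensorHom_tensor_incl_cancel hD hA Δ hΔ) e₁
      (tmul_one_mul_tensorHom _ _ _ _ fun b => (map_mul (incl A) d b).symm) (h.t₁ a d),
    fun d => mul_extension _ (tensorHom_mul (incl A) Δ)
      (fun m n => tensorHom_incl_tensor_cancel' hD hA Δ hΔ) e₂
      (tensorHom_mul_tmul_one _ _ _ _ fun b => (map_mul (incl A) b d).symm) (h.t₂ a d),
    fun d => extension_mul _ (tensorHom_mul (incl A) Δ)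
      (fun m n => tensorHom_incl_tensor_cancel hD hA Δ hΔ) e₂
      (tmul_mul_tensorHom _ _ _ _ fun b => (map_mul (incl A) d b).symm) (h.t₃ a d),
    fun b => extension_mul _ (tensorHom_mul (incl A) Δ)
      (fun m n => tensorHom_incl_tensor_cancel hD hA Δ hΔ) e₂
      (tmul_one_mul_tensorHom _ _ _ _ fun c => (map_mul Δ b c).symm) (h.t₁ a b)⟩

/-- `(x ⊗ 1 ⊗ 1)(Δ ⊙ ι)(Δ(a)(1 ⊗ c)) = (ι ⊙ Δ)((x ⊗ 1)Δ(a))(1 ⊗ 1 ⊗ c)`. -/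
theorem coassoc₂₁ (a x c : A) :
    TensorProduct.assoc ℂ A A A ((fixRight T₂ x).rTensor A (T₁ (a ⊗ₜ c))) =
      (fixRight T₁ c).lTensor A (T₂ (a ⊗ₜ x)) := by
  obtain ⟨E, h₁, h₂, -, -⟩ := h.exists_iterated_comul a
  rw [← LinearEquiv.eq_symm_apply]
  apply h.inj₃
  rw [← mul_tensorHom_left_of (Δ : A →ₗ[ℂ] Mult (A ⊗[ℂ] A)) (inl A x) _ (fun a => h.t₂ a x), ← h₁]
  change _ = incl ((A ⊗[ℂ] A) ⊗[ℂ] A) (assocEquiv A A A _)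
  rw [← congr_assoc_incl,
    ← tensorHom_right_mul_of (Δ : A →ₗ[ℂ] Mult (A ⊗[ℂ] A)) (inr A c) _ (fun a => h.t₁ a c), ← h₂,
    congr_assoc_mul, congr_assoc_mul, congr_assoc_tmul_one, inl, inr, congr_assoc_tmul,
    tmul_one_one, mul_assoc]

/-- `(Δ ⊙ ι)(Δ(a)(1 ⊗ c))(x ⊗ 1 ⊗ 1) = (ι ⊙ Δ)(Δ(a)(x ⊗ 1))(1 ⊗ 1 ⊗ c)`. -/
theorem coassoc₃₁ (a x c : A) :
    TensorProduct.assoc ℂ A A A ((fixRight T₃ x).rTensor A (T₁ (a ⊗ₜ c))) =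
      (fixRight T₁ c).lTensor A (T₃ (a ⊗ₜ x)) := by
  obtain ⟨E, h₁, -, h₃, -⟩ := h.exists_iterated_comul a
  rw [← LinearEquiv.eq_symm_apply]
  apply h.inj₃
  rw [← tensorHom_left_mul_of (Δ : A →ₗ[ℂ] Mult (A ⊗[ℂ] A)) (inl A x) _ (fun a => h.t₃ a x), ← h₁]
  change _ = incl ((A ⊗[ℂ] A) ⊗[ℂ] A) (assocEquiv A A A _)
  rw [← congr_assoc_incl,
    ← tensorHom_right_mul_of (Δ : A →ₗ[ℂ] Mult (A ⊗[ℂ] A)) (inr A c) _ (fun a => h.t₁ a c), ← h₃,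
    congr_assoc_mul, congr_assoc_mul, congr_assoc_tmul_one, inl, inr, congr_assoc_tmul,
    tmul_one_one, mul_assoc, mul_assoc, tmul_mul, tmul_mul, one_mul, mul_one, one_mul, mul_one]

/-- `(ι ⊙ Δ)(Δ(a)(1 ⊗ b))(1 ⊗ r) = (ι ⊙ Δ)(Δ(a))(1 ⊗ Δ(b)r)`, with the right hand side computed
through `(Δ ⊙ ι)(Δ(a))`. -/
theorem lTensor_t₁_of (r : Mult (A ⊗[ℂ] A)) (f : A →ₗ[ℂ] A ⊗[ℂ] A)
    (hf : ∀ s, incl (A ⊗[ℂ] A) (f s) = Δ s * r) (a b : A) :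
    f.lTensor A (T₁ (a ⊗ₜ b)) = doubleComulMul T₁ a (f b) := by
  obtain ⟨E, h₁, -, -, h₄⟩ := h.exists_iterated_comul a
  -- `doubleComulMul T₁ a` is the map w ↦ E(1 ⊗ w), E being the iterated comultiplication of a; the
  -- other side is E(1 ⊗ Δ(b)r).
  have key : ∀ w : A ⊗[ℂ] A, incl (A ⊗[ℂ] (A ⊗[ℂ] A)) (doubleComulMul T₁ a w) =
      E * tmul 1 (incl (A ⊗[ℂ] A) w) := by
    intro w
    induction w with
    | zero =>
      have := (tmulₗ A (A ⊗[ℂ] A) 1).map_zero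
      rw [map_zero, map_zero, map_zero]
      exact ((mul_zero E).symm.trans (congrArg (E * ·) this.symm))
    | add x y hx hy =>
      rw [map_add, map_add, hx, hy, ← mul_add, map_add]
      exact congrArg (E * ·) ((tmulₗ A (A ⊗[ℂ] A) 1).map_add _ _).symm
    | tmul c d =>
      rw [doubleComulMul_tmul]
      apply congr_assoc_injective
      dsimp only
      rw [congr_assoc_incl, congr_assoc_mul, incl_tmul c d, congr_assoc_tmul]
      change incl ((A ⊗[ℂ] A) ⊗[ℂ] A) ((TensorProduct.assoc ℂ A A A).symm _) = _
      rw [LinearEquiv.symm_apply_apply,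
        ← tensorHom_left_mul_of (Δ : A →ₗ[ℂ] Mult (A ⊗[ℂ] A)) (inr A c) _ (fun a => h.t₁ a c),
        ← h₁, mul_assoc, tmul_mul, one_mul, mul_one, inr]
  apply incl_injective (isNondegenerateAlg_tensor h.nondeg h.nondeg₂)
  rw [key, hf, ← tensorHom_right_mul_of (Δ : A →ₗ[ℂ] Mult (A ⊗[ℂ] A)) r f hf, ← h₄, mul_assoc,
    tmul_mul, one_mul]

end IsGaloisMaps

end Coassociativity

/-! ### Module properties of slice maps -/

section Slices

variable {A : Type*} [NonUnitalRing A] [Module ℂ A] [IsScalarTower ℂ A A] [SMulCommClass ℂ A A]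
variable {B : Type*} [NonUnitalRing B] [Module ℂ B] [IsScalarTower ℂ B B] [SMulCommClass ℂ B B]

@[simp] theorem sliceLeft_tmul (ω : Module.Dual ℂ A) (a : A) (b : B) :
    sliceLeft B ω (a ⊗ₜ b) = ω a • b := by simp [sliceLeft]

@[simp] theorem sliceRight_tmul (ω : Module.Dual ℂ B) (a : A) (b : B) :
    sliceRight A ω (a ⊗ₜ b) = ω b • a := by simp [sliceRight]

theorem sliceLeft_inr_lmul (ω : Module.Dual ℂ A) (y : B) (w : A ⊗[ℂ] B) :
    sliceLeft B ω ((inr A y).lmul w) = y * sliceLeft B ω w := by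
  induction w with
  | zero => simp
  | add x y hx hy => simp only [map_add, mul_add, hx, hy]
  | tmul a b => simp [mul_smul_comm]

theorem sliceLeft_inr_rmul (ω : Module.Dual ℂ A) (y : B) (w : A ⊗[ℂ] B) :
    sliceLeft B ω ((inr A y).rmul w) = sliceLeft B ω w * y := by
  induction w with
  | zero => simp
  | add x y hx hy => simp only [map_add, add_mul, hx, hy]
  | tmul a b => simp [smul_mul_assoc]

theorem sliceRight_inl_lmul (ω : Module.Dual ℂ B) (y : A) (w : A ⊗[ℂ] B) :
    sliceRight A ω ((inl B y).lmul w) = y * sliceRight A ω w := by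
  induction w with
  | zero => simp
  | add x y hx hy => simp only [map_add, mul_add, hx, hy]
  | tmul a b => simp [mul_smul_comm]

theorem sliceRight_inl_rmul (ω : Module.Dual ℂ B) (y : A) (w : A ⊗[ℂ] B) :
    sliceRight A ω ((inl B y).rmul w) = sliceRight A ω w * y := by
  induction w with
  | zero => simp
  | add x y hx hy => simp only [map_add, add_mul, hx, hy]
  | tmul a b => simp [smul_mul_assoc]

end Slices

/-! ### The Galois maps as module maps, and the counit -/

namespace IsGaloisMaps

variable {A : Type*} [NonUnitalRing A] [Module ℂ A] [IsScalarTower ℂ A A] [SMulCommClass ℂ A A]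
variable {Δ : A →ₙₐ[ℂ] Mult (A ⊗[ℂ] A)} {T₁ T₂ T₃ T₄ : A ⊗[ℂ] A ≃ₗ[ℂ] A ⊗[ℂ] A}
  (h : IsGaloisMaps Δ T₁ T₂ T₃ T₄)

include h

theorem inl_lmul_t₁ (x a c : A) :
    (inl A x).lmul (T₁ (a ⊗ₜ c)) = (inr A c).rmul (T₂ (a ⊗ₜ x)) := by
  apply h.inj
  rw [← mul_incl, ← incl_mul, h.t₁, h.t₂, mul_assoc]

theorem inl_lmul_t₃ (x a c : A) :
    (inl A x).lmul (T₃ (a ⊗ₜ c)) = (inl A c).rmul (T₂ (a ⊗ₜ x)) := by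
  apply h.inj
  rw [← mul_incl, ← incl_mul, h.t₃, h.t₂, mul_assoc]

theorem inr_lmul_t₁ (x a c : A) :
    (inr A x).lmul (T₁ (a ⊗ₜ c)) = (inr A c).rmul (T₄ (a ⊗ₜ x)) := by
  apply h.inj
  rw [← mul_incl, ← incl_mul, h.t₁, h.t₄, mul_assoc]

theorem inr_lmul_t₃ (x a c : A) :
    (inr A x).lmul (T₃ (a ⊗ₜ c)) = (inl A c).rmul (T₄ (a ⊗ₜ x)) := by
  apply h.inj
  rw [← mul_incl, ← incl_mul, h.t₃, h.t₄, mul_assoc]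

theorem inr_rmul_t₃ (b a c : A) :
    (inr A c).rmul (T₃ (b ⊗ₜ a)) = (inl A a).rmul (T₁ (b ⊗ₜ c)) := by
  apply h.inj
  rw [← incl_mul, ← incl_mul, h.t₁, h.t₃, mul_assoc, mul_assoc, commute_inl_inr]

theorem t₁_inr_rmul (c : A) (w : A ⊗[ℂ] A) : T₁ ((inr A c).rmul w) = (inr A c).rmul (T₁ w) := by
  induction w with
  | zero => simp
  | add x y hx hy => simp only [map_add, hx, hy]
  | tmul a b =>
    apply h.inj
    rw [← incl_mul, inr_rmul_tmul, h.t₁, h.t₁, mul_assoc, inr_mul]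

theorem t₁_symm_inr_rmul (c : A) (w : A ⊗[ℂ] A) :
    T₁.symm ((inr A c).rmul w) = (inr A c).rmul (T₁.symm w) := by
  rw [LinearEquiv.symm_apply_eq, h.t₁_inr_rmul, LinearEquiv.apply_symm_apply]

theorem t₁_inl_lmul (x : A) (w : A ⊗[ℂ] A) : T₁ ((inl A x).lmul w) = (Δ x).lmul (T₁ w) := by
  induction w with
  | zero => simp
  | add x y hx hy => simp only [map_add, hx, hy]
  | tmul a b =>
    apply h.inj
    rw [← mul_incl, inl_lmul_tmul, h.t₁, h.t₁, ← mul_assoc, map_mul]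

theorem t₃_inl_lmul (x : A) (w : A ⊗[ℂ] A) : T₃ ((inl A x).lmul w) = (Δ x).lmul (T₃ w) := by
  induction w with
  | zero => simp
  | add x y hx hy => simp only [map_add, hx, hy]
  | tmul a b =>
    apply h.inj
    rw [← mul_incl, inl_lmul_tmul, h.t₃, h.t₃, ← mul_assoc, map_mul]

theorem t₂_mul (a b x : A) : T₂ ((a * b) ⊗ₜ x) = (Δ b).rmul (T₂ (a ⊗ₜ x)) := by
  apply h.inj
  rw [← incl_mul, h.t₂, h.t₂, map_mul, mul_assoc]

theorem comul_rmul_tmul (b x p : A) : (Δ b).rmul (x ⊗ₜ p) = (inr A p).lmul (T₂ (b ⊗ₜ x)) := by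
  apply h.inj
  rw [← incl_mul, ← mul_incl, h.t₂, ← mul_assoc, inr_mul_inl]

/-- `coassoc₂₁` says that w ↦ (T₂(· ⊗ x) ⊙ ι)(w) intertwines T₁ with ι ⊙ T₁; inverting both gives x
a₁ ⊗ T₁⁻¹(a₂ ⊗ b). -/
theorem lTensor_t₁_symm (a x b : A) :
    T₁.symm.toLinearMap.lTensor A (TensorProduct.assoc ℂ A A A (T₂ (a ⊗ₜ x) ⊗ₜ b)) =
      TensorProduct.assoc ℂ A A A ((fixRight T₂ x).rTensor A (T₁.symm (a ⊗ₜ b))) := by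
  have key : ∀ w : A ⊗[ℂ] A, TensorProduct.assoc ℂ A A A ((fixRight T₂ x).rTensor A (T₁ w)) =
      T₁.toLinearMap.lTensor A
        (TensorProduct.assoc ℂ A A A ((fixRight T₂ x).rTensor A w)) := by
    intro w
    induction w with
    | zero => simp
    | add x y hx hy => simp only [map_add, hx, hy]
    | tmul d e =>
      rw [h.coassoc₂₁, LinearMap.rTensor_tmul, fixRight_apply]
      induction T₂ (d ⊗ₜ x) with
      | zero => simp
      | add x y hx hy => simp only [map_add, TensorProduct.add_tmul, hx, hy]
      | tmul p q => simp
  have h2 := key (T₁.symm (a ⊗ₜ b))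
  rw [LinearEquiv.apply_symm_apply, LinearMap.rTensor_tmul, fixRight_apply] at h2
  rw [h2, ← LinearMap.comp_apply, ← LinearMap.lTensor_comp]
  simp

/-- `x a₁ ⊗ m(T₁⁻¹(a₂ ⊗ b)) = x a ⊗ b`. -/
theorem lTensor_mul_t₁_symm (a x b : A) :
    (LinearMap.mul' ℂ A ∘ₗ T₁.symm.toLinearMap).lTensor A
      (TensorProduct.assoc ℂ A A A (T₂ (a ⊗ₜ x) ⊗ₜ b)) = (x * a) ⊗ₜ b := by
  have key : ∀ w : A ⊗[ℂ] A, (LinearMap.mul' ℂ A).lTensor A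
      (TensorProduct.assoc ℂ A A A ((fixRight T₂ x).rTensor A w)) = (inl A x).lmul (T₁ w) := by
    intro w
    induction w with
    | zero => simp
    | add x y hx hy => simp only [map_add, hx, hy]
    | tmul d e =>
      rw [h.inl_lmul_t₁, LinearMap.rTensor_tmul, fixRight_apply]
      induction T₂ (d ⊗ₜ x) with
      | zero => simp
      | add x y hx hy => simp only [map_add, TensorProduct.add_tmul, hx, hy]
      | tmul p q => simp
  rw [LinearMap.lTensor_comp, LinearMap.comp_apply, h.lTensor_t₁_symm, key,
    LinearEquiv.apply_symm_apply, inl_lmul_tmul]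

/-- The counit as a linear functional. -/
theorem exists_counit_functional (hA : ∃ a : A, a ≠ 0) : ∃ ε : Module.Dual ℂ A,
    (∀ w, sliceLeft A ε (T₁ w) = LinearMap.mul' ℂ A w) ∧
    (∀ a b, sliceRight A ε (T₂ (a ⊗ₜ b)) = b * a) := by
  obtain ⟨p, hp⟩ := hA
  obtain ⟨f, hf⟩ : ∃ f : Module.Dual ℂ A, f p = 1 := by
    obtain ⟨f, hf⟩ := not_forall.1 (mt (Module.forall_dual_apply_eq_zero_iff ℂ p).1 hp)
    exact ⟨(f p)⁻¹ • f, by simp [hf]⟩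
  let M : A ⊗[ℂ] A →ₗ[ℂ] A :=
    LinearMap.mul' ℂ A ∘ₗ (TensorProduct.comm ℂ A A).toLinearMap ∘ₗ T₂.symm.toLinearMap
  have key : ∀ z b, (LinearMap.mul' ℂ A ∘ₗ T₁.symm.toLinearMap).lTensor A
      (TensorProduct.assoc ℂ A A A (z ⊗ₜ b)) = M z ⊗ₜ b := by
    intro z b
    obtain ⟨w, rfl⟩ := T₂.surjective z
    induction w with
    | zero => simp
    | add x y hx hy => simp only [map_add, TensorProduct.add_tmul, hx, hy]
    | tmul a x => rw [h.lTensor_mul_t₁_symm]; simp [M]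
  -- An identity x ⊗ F(q, b) = M(x ⊗ q) ⊗ b forces both sides to be a scalar depending on q alone
  -- times x ⊗ b; this scalar is ε(q).
  have key' : ∀ x q b : A, x ⊗ₜ[ℂ] LinearMap.mul' ℂ A (T₁.symm (q ⊗ₜ b)) = M (x ⊗ₜ q) ⊗ₜ b :=
    fun x q b => key (x ⊗ₜ q) b
  let ε : Module.Dual ℂ A := f ∘ₗ M ∘ₗ TensorProduct.mk ℂ A A p
  have hε : ∀ q b, LinearMap.mul' ℂ A (T₁.symm (q ⊗ₜ b)) = ε q • b := by
    intro q b
    have := congrArg (sliceLeft A f) (key' p q b)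
    simpa [hf, ε] using this
  have hM : ∀ x q, M (x ⊗ₜ q) = ε q • x := by
    intro x q
    have := key' x q p
    rw [hε] at this
    have := congrArg (sliceRight A f) this
    simpa [hf] using this.symm
  refine ⟨ε, fun w => ?_, fun a b => ?_⟩
  · obtain ⟨z, rfl⟩ := T₁.symm.surjective w
    rw [LinearEquiv.apply_symm_apply]
    induction z with
    | zero => simp
    | add x y hx hy => simp only [map_add, hx, hy]
    | tmul q b => rw [hε, sliceLeft_tmul]
  · have hM' : ∀ z, M z = sliceRight A ε z := by
      intro z
      induction z with
      | zero => simp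
      | add x y hx hy => simp only [map_add, hx, hy]
      | tmul q b => rw [hM, sliceRight_tmul]
    rw [← hM']
    simp [M]

theorem sliceRight_comul_rmul {ε : Module.Dual ℂ A}
    (h₂ : ∀ a b, sliceRight A ε (T₂ (a ⊗ₜ b)) = b * a) (b : A) (w : A ⊗[ℂ] A) :
    sliceRight A ε ((Δ b).rmul w) = sliceRight A ε w * b := by
  obtain ⟨z, rfl⟩ := T₂.surjective w
  induction z with
  | zero => simp
  | add x y hx hy => simp only [map_add, hx, hy, add_mul]
  | tmul a x => rw [← h.t₂_mul, h₂, h₂, mul_assoc]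

theorem exists_isCounit (hA : ∃ a : A, a ≠ 0) : ∃ ε, IsCounit Δ ε := by
  obtain ⟨ε, h₁, h₂⟩ := h.exists_counit_functional hA
  obtain ⟨p, hp⟩ := hA
  have hmul : ∀ q s, ε (q * s) = ε q * ε s := by
    -- Elements (x ⊗ 1)Δ(b) fill A ⊙ A, and (1 ⊗ q) times such an element is (x ⊗ q)Δ(b), whose
    -- slice is ε(q) x b.
    have key : ∀ (q : A) (w : A ⊗[ℂ] A), sliceRight A ε ((inr A q).lmul w) =
        ε q • sliceRight A ε w := by
      intro q w
      obtain ⟨z, rfl⟩ := T₂.surjective w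
      induction z with
      | zero => simp
      | add x y hx hy => simp only [map_add, hx, hy, smul_add]
      | tmul b x =>
        rw [← h.comul_rmul_tmul, h.sliceRight_comul_rmul h₂, sliceRight_tmul, smul_mul_assoc, h₂]
    intro q s
    have := key q (p ⊗ₜ s)
    rw [inr_lmul_tmul, sliceRight_tmul, sliceRight_tmul, smul_smul] at this
    exact smul_left_injective ℂ hp this
  let ε' : A →ₙₐ[ℂ] ℂ := { ε with map_mul' := hmul, map_zero' := map_zero ε }
  have hε' : (ε' : A →ₗ[ℂ] ℂ) = ε := rfl
  refine ⟨ε', ⟨fun h0 => hp (h.nondeg.2 p fun b => ?_), fun a b => ⟨?_, ?_⟩,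
    fun a b => ⟨?_, ?_⟩⟩⟩
  · have : ε = 0 := by rw [← hε', h0]; rfl
    rw [← h₂, this]
    simp [sliceRight]
  · exact ⟨_, h.t₁ a b, by rw [hε', h₁]; simp [incl_lmul]⟩
  -- The construction controls only T₁ and T₂. The values on T₄, and below on T₃, follow by
  -- multiplying by a further element on the opposite side.
  · refine ⟨_, h.t₄ a b, sub_eq_zero.1 (h.nondeg.1 _ fun c => ?_)⟩
    rw [sub_mul, hε', ← sliceLeft_inr_rmul, ← h.inr_lmul_t₁, sliceLeft_inr_lmul, h₁]
    simp [incl_rmul, mul_assoc]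
  · refine ⟨_, h.t₃ a b, sub_eq_zero.1 (h.nondeg.2 _ fun c => ?_)⟩
    rw [mul_sub, hε', ← sliceRight_inl_lmul, h.inl_lmul_t₃, sliceRight_inl_rmul, h₂]
    simp [incl_lmul, mul_assoc]
  · exact ⟨_, h.t₂ a b, by rw [hε', h₂]; simp [incl_rmul]⟩

end IsGaloisMaps

/-! ### Local units from the Haar functional -/

section LocalUnits

variable {A : Type*} [NonUnitalRing A] [Module ℂ A] [IsScalarTower ℂ A A] [SMulCommClass ℂ A A]
variable {B : Type*} [NonUnitalRing B] [Module ℂ B] [IsScalarTower ℂ B B] [SMulCommClass ℂ B B]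
variable {Δ : A →ₙₐ[ℂ] Mult (A ⊗[ℂ] A)} {T₁ T₂ T₃ T₄ : A ⊗[ℂ] A ≃ₗ[ℂ] A ⊗[ℂ] A}

theorem map_sliceLeft (η φ : Module.Dual ℂ A) (w : A ⊗[ℂ] A) :
    φ (sliceLeft A η w) = η (sliceRight A φ w) := by
  induction w with
  | zero => simp
  | add x y hx hy => simp only [map_add, hx, hy]
  | tmul a b => simp [mul_comm]

theorem sliceLeft_inl_lmul (η : Module.Dual ℂ A) (x : A) (w : A ⊗[ℂ] B) :
    sliceLeft B η ((inl B x).lmul w) = sliceLeft B (η ∘ₗ LinearMap.mulLeft ℂ x) w := by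
  induction w with
  | zero => simp
  | add x y hx hy => simp only [map_add, hx, hy]
  | tmul a b => simp

theorem sliceLeft_inl_rmul (η : Module.Dual ℂ A) (x : A) (w : A ⊗[ℂ] B) :
    sliceLeft B η ((inl B x).rmul w) = sliceLeft B (η ∘ₗ LinearMap.mulRight ℂ x) w := by
  induction w with
  | zero => simp
  | add x y hx hy => simp only [map_add, hx, hy]
  | tmul a b => simp

/-- The map `a ⊗ c ↦ (f(· ⊗ c) ⊙ ι)(t a)`. -/
def sliceAux {C : Type*} [AddCommGroup C] [Module ℂ C] (f : Module.Dual ℂ (A ⊗[ℂ] C))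
    (t : A →ₗ[ℂ] A ⊗[ℂ] A) : A ⊗[ℂ] C →ₗ[ℂ] A :=
  (TensorProduct.lid ℂ A).toLinearMap ∘ₗ f.rTensor A ∘ₗ
    (TensorProduct.rightComm ℂ A A C).toLinearMap ∘ₗ t.rTensor C

theorem sliceAux_tmul {C : Type*} [AddCommGroup C] [Module ℂ C] (f : Module.Dual ℂ (A ⊗[ℂ] C))
    (t : A →ₗ[ℂ] A ⊗[ℂ] A) (a : A) (c : C) :
    sliceAux f t (a ⊗ₜ c) = sliceLeft A (f ∘ₗ (TensorProduct.mk ℂ A C).flip c) (t a) := by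
  simp only [sliceAux, LinearMap.comp_apply, LinearMap.rTensor_tmul, LinearEquiv.coe_coe]
  induction t a with
  | zero => simp
  | add x y hx hy => simp only [map_add, TensorProduct.add_tmul, hx, hy]
  | tmul a b => simp

namespace IsGaloisMaps

variable (h : IsGaloisMaps Δ T₁ T₂ T₃ T₄) {φ : Module.Dual ℂ A} (hφ : IsLeftHaar Δ φ)

include h hφ

theorem haar_t₃ (a b : A) : sliceRight A φ (T₃ (a ⊗ₜ b)) = φ a • b := by
  obtain ⟨x, hx, hx'⟩ := (hφ.left_invariant a b).1
  rw [h.inj ((h.t₃ a b).trans hx.symm), ← hx']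
  rfl

theorem haar_t₂ (a b : A) : sliceRight A φ (T₂ (a ⊗ₜ b)) = φ a • b := by
  obtain ⟨x, hx, hx'⟩ := (hφ.left_invariant a b).2
  rw [h.inj ((h.t₂ a b).trans hx.symm), ← hx']
  rfl

/-- Left local units. -/
theorem exists_left_unit {C : Type*} [AddCommGroup C] [Module ℂ C] (z : A ⊗[ℂ] C) :
    ∃ e : A, (LinearMap.mulLeft ℂ e).rTensor C z = z := by
  let act : A ⊗[ℂ] C →ₗ[ℂ] A →ₗ[ℂ] A ⊗[ℂ] C :=
    ((LinearMap.rTensorHom C).comp (LinearMap.mul ℂ A)).flip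
  have hact : ∀ z e, act z e = (LinearMap.mulLeft ℂ e).rTensor C z := fun _ _ => rfl
  -- If z ∉ A z, some functional f vanishes on A z but not at z. For z = Σ aᵢ ⊗ cᵢ and φ(p) ≠ 0, the
  -- element Σ (f(· ⊗ cᵢ) ⊙ ι)(Δ(p)(aᵢ ⊗ 1)) is annihilated by every b on the left, hence zero; yet
  -- left invariance gives it the φ-value φ(p)f(z).
  by_contra hne
  have hz : z ∉ LinearMap.range (act z) := by
    rintro ⟨e, he⟩
    exact hne ⟨e, he⟩
  obtain ⟨f, hfz, hf⟩ := Submodule.exists_dual_map_eq_bot_of_notMem hz inferInstance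
  have hf0 : f ∘ₗ act z = 0 := by
    ext e
    have : f (act z e) ∈ (LinearMap.range (act z)).map f := ⟨_, ⟨e, rfl⟩, rfl⟩
    rw [hf] at this
    exact this
  obtain ⟨p, hp⟩ : ∃ p, φ p ≠ 0 := not_forall.1 fun h0 => hφ.ne_zero (LinearMap.ext h0)
  let t : A →ₗ[ℂ] A ⊗[ℂ] A := T₃.toLinearMap ∘ₗ TensorProduct.mk ℂ A A p
  have h₁ : ∀ (b : A) z', b * sliceAux f t z' = sliceLeft A (f ∘ₗ act z') (T₄ (p ⊗ₜ b)) := by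
    intro b z'
    induction z' with
    | zero => simp [sliceLeft]
    | add x y hx hy =>
      rw [map_add, mul_add, hx, hy, map_add, LinearMap.comp_add]
      simp [sliceLeft, LinearMap.rTensor_add]
    | tmul a c =>
      rw [sliceAux_tmul, ← sliceLeft_inr_lmul]
      change sliceLeft A _ ((inr A b).lmul (T₃ (p ⊗ₜ a))) = _
      rw [h.inr_lmul_t₃, sliceLeft_inl_rmul]
      rfl
  have h₂ : ∀ z', φ (sliceAux f t z') = φ p * f z' := by
    intro z'
    induction z' with
    | zero => simp
    | add x y hx hy => simp only [map_add, mul_add, hx, hy]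
    | tmul a c =>
      rw [sliceAux_tmul, map_sliceLeft]
      change (f ∘ₗ (TensorProduct.mk ℂ A C).flip c) (sliceRight A φ (T₃ (p ⊗ₜ a))) = _
      rw [h.haar_t₃ hφ, map_smul]
      rfl
  have h₃ : sliceAux f t z = 0 := h.nondeg.2 _ fun b => by
    rw [h₁, hf0]
    simp [sliceLeft]
  have := h₂ z
  rw [h₃, map_zero] at this
  exact mul_ne_zero hp hfz this.symm

/-- Right local units. -/
theorem exists_right_unit {C : Type*} [AddCommGroup C] [Module ℂ C] (z : A ⊗[ℂ] C) :
    ∃ e : A, (LinearMap.mulRight ℂ e).rTensor C z = z := by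
  let act : A ⊗[ℂ] C →ₗ[ℂ] A →ₗ[ℂ] A ⊗[ℂ] C :=
    ((LinearMap.rTensorHom C).comp (LinearMap.mul ℂ A).flip).flip
  -- The mirror argument, with (aᵢ ⊗ 1)Δ(p) in place of Δ(p)(aᵢ ⊗ 1) and f vanishing on the right
  -- translates of z.
  by_contra hne
  have hz : z ∉ LinearMap.range (act z) := by
    rintro ⟨e, he⟩
    exact hne ⟨e, he⟩
  obtain ⟨f, hfz, hf⟩ := Submodule.exists_dual_map_eq_bot_of_notMem hz inferInstance
  have hf0 : f ∘ₗ act z = 0 := by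
    ext e
    have : f (act z e) ∈ (LinearMap.range (act z)).map f := ⟨_, ⟨e, rfl⟩, rfl⟩
    rw [hf] at this
    exact this
  obtain ⟨p, hp⟩ : ∃ p, φ p ≠ 0 := not_forall.1 fun h0 => hφ.ne_zero (LinearMap.ext h0)
  let t : A →ₗ[ℂ] A ⊗[ℂ] A := T₂.toLinearMap ∘ₗ TensorProduct.mk ℂ A A p
  have h₁ : ∀ (b : A) z', sliceAux f t z' * b = sliceLeft A (f ∘ₗ act z') (T₁ (p ⊗ₜ b)) := by
    intro b z'
    induction z' with
    | zero => simp [sliceLeft]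
    | add x y hx hy =>
      rw [map_add, add_mul, hx, hy, map_add, LinearMap.comp_add]
      simp [sliceLeft, LinearMap.rTensor_add]
    | tmul a c =>
      rw [sliceAux_tmul, ← sliceLeft_inr_rmul]
      change sliceLeft A _ ((inr A b).rmul (T₂ (p ⊗ₜ a))) = _
      rw [← h.inl_lmul_t₁, sliceLeft_inl_lmul]
      rfl
  have h₂ : ∀ z', φ (sliceAux f t z') = φ p * f z' := by
    intro z'
    induction z' with
    | zero => simp
    | add x y hx hy => simp only [map_add, mul_add, hx, hy]
    | tmul a c =>
      rw [sliceAux_tmul, map_sliceLeft]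
      change (f ∘ₗ (TensorProduct.mk ℂ A C).flip c) (sliceRight A φ (T₂ (p ⊗ₜ a))) = _
      rw [h.haar_t₂ hφ, map_smul]
      rfl
  have h₃ : sliceAux f t z = 0 := h.nondeg.1 _ fun b => by
    rw [h₁, hf0]
    simp [sliceLeft]
  have := h₂ z
  rw [h₃, map_zero] at this
  exact mul_ne_zero hp hfz this.symm

theorem exists_mul_eq_self (a : A) : ∃ e, a * e = a := by
  obtain ⟨e, he⟩ := h.exists_right_unit hφ (a ⊗ₜ[ℂ] (1 : ℂ))
  exact ⟨e, by simpa using congrArg (TensorProduct.rid ℂ A) he⟩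

/-- Two-sided local units. -/
theorem exists_unit {C : Type*} [AddCommGroup C] [Module ℂ C] (z : A ⊗[ℂ] C) (a : A) :
    ∃ e : A, (LinearMap.mulLeft ℂ e).rTensor C z = z ∧ a * e = a := by
  obtain ⟨e₁, h₁⟩ := h.exists_left_unit hφ z
  obtain ⟨e₂, h₂⟩ := h.exists_mul_eq_self hφ a
  -- Chosen so that 1 - e = (1 - e₂)(1 - e₁): the right factor kills z, the left factor is killed by
  -- a.
  refine ⟨e₁ + e₂ - e₂ * e₁, ?_, ?_⟩
  · have : LinearMap.mulLeft ℂ (e₁ + e₂ - e₂ * e₁) = LinearMap.mulLeft ℂ e₁ +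
        LinearMap.mulLeft ℂ e₂ - LinearMap.mulLeft ℂ e₂ ∘ₗ LinearMap.mulLeft ℂ e₁ := by
      ext x; simp [sub_mul, add_mul, mul_assoc]
    rw [this, LinearMap.rTensor_sub, LinearMap.rTensor_add, LinearMap.rTensor_comp,
      LinearMap.sub_apply, LinearMap.add_apply, LinearMap.comp_apply, h₁, add_sub_cancel_right]
  · rw [mul_sub, mul_add, ← mul_assoc, h₂, add_sub_cancel_left]

end IsGaloisMaps

end LocalUnits

/-! ### Construction of the antipode -/

section Antipode

variable {A : Type*} [NonUnitalRing A] [Module ℂ A] [IsScalarTower ℂ A A] [SMulCommClass ℂ A A]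
variable {Δ : A →ₙₐ[ℂ] Mult (A ⊗[ℂ] A)} {T₁ T₂ T₃ T₄ : A ⊗[ℂ] A ≃ₗ[ℂ] A ⊗[ℂ] A}

theorem IsLeftHaar.exists_ne_zero {φ : Module.Dual ℂ A} (hφ : IsLeftHaar Δ φ) :
    ∃ a : A, a ≠ 0 := by
  by_contra! h0
  exact hφ.ne_zero (LinearMap.ext fun a => by rw [h0 a, map_zero, map_zero])

theorem IsCounit.exists_eq_one {ε : A →ₙₐ[ℂ] ℂ} (hε : IsCounit Δ ε) : ∃ b, ε b = 1 := by
  obtain ⟨b, hb⟩ : ∃ b, ε b ≠ 0 := not_forall.1 fun h0 =>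
    hε.ne_zero (DFunLike.ext _ _ h0)
  exact ⟨(ε b)⁻¹ • b, by rw [map_smul, smul_eq_mul, inv_mul_cancel₀ hb]⟩

namespace IsGaloisMaps

variable (h : IsGaloisMaps Δ T₁ T₂ T₃ T₄)

include h

section Counit

variable {ε : A →ₙₐ[ℂ] ℂ} (hε : IsCounit Δ ε)

include hε

theorem counit_t₁ (a b : A) : sliceLeft A (ε : A →ₗ[ℂ] ℂ) (T₁ (a ⊗ₜ b)) = a * b := by
  obtain ⟨x, hx, hx'⟩ := (hε.left a b).1
  rw [h.inj ((h.t₁ a b).trans hx.symm), ← hx']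
  rfl

theorem counit_t₃ (a b : A) : sliceRight A (ε : A →ₗ[ℂ] ℂ) (T₃ (a ⊗ₜ b)) = a * b := by
  obtain ⟨x, hx, hx'⟩ := (hε.right a b).1
  rw [h.inj ((h.t₃ a b).trans hx.symm), ← hx']
  rfl

theorem counit_t₂ (a b : A) : sliceRight A (ε : A →ₗ[ℂ] ℂ) (T₂ (a ⊗ₜ b)) = b * a := by
  obtain ⟨x, hx, hx'⟩ := (hε.right a b).2
  rw [h.inj ((h.t₂ a b).trans hx.symm), ← hx']
  rfl

/-- The inverse reading of (ε ⊙ ι)(Δ(a)(1 ⊗ b)) = a b. -/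
theorem mul_t₁_symm (w : A ⊗[ℂ] A) :
    LinearMap.mul' ℂ A (T₁.symm w) = sliceLeft A (ε : A →ₗ[ℂ] ℂ) w := by
  obtain ⟨z, rfl⟩ := T₁.surjective w
  rw [LinearEquiv.symm_apply_apply]
  induction z with
  | zero => simp
  | add x y hx hy => simp only [map_add, hx, hy]
  | tmul a b => rw [h.counit_t₁ hε, LinearMap.mul'_apply]

/-- A linear map of `A ⊙ A` commuting with left multiplication on the first leg induces a map on
the second leg. -/
theorem exists_of_commute_inl {φ : Module.Dual ℂ A} (hφ : IsLeftHaar Δ φ)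
    (Φ : A ⊗[ℂ] A →ₗ[ℂ] A ⊗[ℂ] A)
    (hΦ : ∀ x w, Φ ((inl A x).lmul w) = (inl A x).lmul (Φ w)) :
    ∃ S : A →ₗ[ℂ] A, ∀ w, sliceLeft A (ε : A →ₗ[ℂ] ℂ) (Φ w) =
      S (sliceLeft A (ε : A →ₗ[ℂ] ℂ) w) := by
  obtain ⟨b₀, hb₀⟩ := hε.exists_eq_one
  -- A local unit gives k ⊗ a = (k ⊗ 1)(e ⊗ a); Φ lets k ⊗ 1 pass, and ε(k ·) = 0. So (ε ⊙ ι)Φ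
  -- factors through (ε ⊙ ι).
  have key : ∀ k a, ε k = 0 → sliceLeft A (ε : A →ₗ[ℂ] ℂ) (Φ (k ⊗ₜ a)) = 0 := by
    intro k a hk
    obtain ⟨e, he⟩ := h.exists_mul_eq_self hφ k
    have h0 : (ε : A →ₗ[ℂ] ℂ) ∘ₗ LinearMap.mulLeft ℂ k = 0 := by
      ext x
      change ε (k * x) = 0
      rw [map_mul, hk, zero_mul]
    rw [← he, ← inl_lmul_tmul, hΦ, sliceLeft_inl_lmul, h0]
    simp [sliceLeft]
  refine ⟨sliceLeft A (ε : A →ₗ[ℂ] ℂ) ∘ₗ Φ ∘ₗ TensorProduct.mk ℂ A A b₀, fun w => ?_⟩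
  induction w with
  | zero => simp
  | add x y hx hy => simp only [map_add, hx, hy]
  | tmul b a =>
    have := key (b - ε b • b₀) a (by rw [map_sub, map_smul, hb₀, smul_eq_mul, mul_one, sub_self])
    rw [TensorProduct.sub_tmul, map_sub, map_sub, sub_eq_zero] at this
    rw [this, sliceLeft_tmul, ← TensorProduct.smul_tmul']
    simp

/-- T₁ and T₃ both turn left multiplication by x ⊗ 1 into left multiplication by Δ(x), so their
quotient commutes with x ⊗ 1. -/
theorem t₁_symm_t₃_inl_lmul (x : A) (w : A ⊗[ℂ] A) :
    T₁.symm (T₃ ((inl A x).lmul w)) = (inl A x).lmul (T₁.symm (T₃ w)) := by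
  rw [LinearEquiv.symm_apply_eq, h.t₁_inl_lmul, h.t₃_inl_lmul, LinearEquiv.apply_symm_apply]

theorem t₃_symm_t₁_inl_lmul (x : A) (w : A ⊗[ℂ] A) :
    T₃.symm (T₁ ((inl A x).lmul w)) = (inl A x).lmul (T₃.symm (T₁ w)) := by
  rw [LinearEquiv.symm_apply_eq, h.t₁_inl_lmul, h.t₃_inl_lmul, LinearEquiv.apply_symm_apply]

/-- Formally T₁⁻¹T₃(b ⊗ a) = b a₁ ⊗ S(a₂), so applying ε to the first leg leaves ε(b)S(a). The
inverse of S is induced in the same way by T₃⁻¹T₁. -/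
theorem exists_antipode_equiv {φ : Module.Dual ℂ A} (hφ : IsLeftHaar Δ φ) :
    ∃ S : A ≃ₗ[ℂ] A, ∀ w, sliceLeft A (ε : A →ₗ[ℂ] ℂ) (T₁.symm (T₃ w)) =
      S (sliceLeft A (ε : A →ₗ[ℂ] ℂ) w) := by
  obtain ⟨S, hS⟩ := h.exists_of_commute_inl hε hφ (T₁.symm.toLinearMap ∘ₗ T₃.toLinearMap)
    (h.t₁_symm_t₃_inl_lmul hε)
  obtain ⟨S', hS'⟩ := h.exists_of_commute_inl hε hφ (T₃.symm.toLinearMap ∘ₗ T₁.toLinearMap)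
    (h.t₃_symm_t₁_inl_lmul hε)
  obtain ⟨b₀, hb₀⟩ := hε.exists_eq_one
  have hb : ∀ a, sliceLeft A (ε : A →ₗ[ℂ] ℂ) (b₀ ⊗ₜ a) = a := fun a => by
    rw [sliceLeft_tmul]
    change ε b₀ • a = a
    rw [hb₀, one_smul]
  refine ⟨LinearEquiv.ofLinearMap S S' (LinearMap.ext fun a => ?_) (LinearMap.ext fun a => ?_), hS⟩
  · rw [LinearMap.comp_apply, LinearMap.id_apply, ← hb a, ← hS', ← hS]
    simp
  · rw [LinearMap.comp_apply, LinearMap.id_apply, ← hb a, ← hS, ← hS']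
    simp

/-- `G(a ⊗ c) = (ε ⊙ ι)T₁⁻¹(a ⊗ c)`, satisfies `y p₁ G(p₂ ⊗ c) = ε(p) y c`. -/
theorem mul_sliceLeft_t₁_symm (a x b : A) :
    LinearMap.mul' ℂ A ((sliceLeft A (ε : A →ₗ[ℂ] ℂ) ∘ₗ T₁.symm.toLinearMap).lTensor A
      (TensorProduct.assoc ℂ A A A (T₂ (a ⊗ₜ x) ⊗ₜ b))) = ε a • (x * b) := by
  have key : ∀ w : A ⊗[ℂ] A, (sliceLeft A (ε : A →ₗ[ℂ] ℂ)).lTensor A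
      (TensorProduct.assoc ℂ A A A ((fixRight T₂ x).rTensor A w)) = (inl A x).lmul w := by
    intro w
    induction w with
    | zero => simp
    | add x y hx hy => simp only [map_add, hx, hy]
    | tmul d e =>
      have : ∀ z : A ⊗[ℂ] A, (sliceLeft A (ε : A →ₗ[ℂ] ℂ)).lTensor A
          (TensorProduct.assoc ℂ A A A (z ⊗ₜ e)) = sliceRight A (ε : A →ₗ[ℂ] ℂ) z ⊗ₜ e := by
        intro z
        induction z with
        | zero => simp
        | add x y hx hy => simp only [map_add, TensorProduct.add_tmul, hx, hy]
        | tmul p q => simp [TensorProduct.smul_tmul]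
      rw [LinearMap.rTensor_tmul, fixRight_apply, this, h.counit_t₂ hε, inl_lmul_tmul]
  have key₂ : ∀ w : A ⊗[ℂ] A, LinearMap.mul' ℂ A ((inl A x).lmul w) =
      x * LinearMap.mul' ℂ A w := by
    intro w
    induction w with
    | zero => simp
    | add x y hx hy => simp only [map_add, mul_add, hx, hy]
    | tmul d e => simp [mul_assoc]
  rw [LinearMap.lTensor_comp, LinearMap.comp_apply, h.lTensor_t₁_symm, key, key₂,
    h.mul_t₁_symm hε, sliceLeft_tmul, mul_smul_comm]
  rfl

/-- With G(p ⊗ c) = (ε ⊙ ι)T₁⁻¹(p ⊗ c), to be identified with S(p)c, this is anti-multiplicativity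
of S, available before that identification. It holds because y ⊗ p ↦ y G(p ⊗ c) is determined on the
range of T₂ by ε, which is multiplicative. -/
theorem sliceLeft_t₁_symm_mul (p q c : A) :
    sliceLeft A (ε : A →ₗ[ℂ] ℂ) (T₁.symm ((p * q) ⊗ₜ c)) = sliceLeft A (ε : A →ₗ[ℂ] ℂ)
      (T₁.symm (q ⊗ₜ sliceLeft A (ε : A →ₗ[ℂ] ℂ) (T₁.symm (p ⊗ₜ c)))) := by
  set G : A ⊗[ℂ] A →ₗ[ℂ] A := sliceLeft A (ε : A →ₗ[ℂ] ℂ) ∘ₗ T₁.symm.toLinearMap with hG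
  let J : A → A ⊗[ℂ] A →ₗ[ℂ] A := fun c => LinearMap.mul' ℂ A ∘ₗ G.lTensor A ∘ₗ
    (TensorProduct.assoc ℂ A A A).toLinearMap ∘ₗ (TensorProduct.mk ℂ (A ⊗[ℂ] A) A).flip c
  have hJ : ∀ c a x, J c (T₂ (a ⊗ₜ x)) = ε a • (x * c) := fun c a x =>
    h.mul_sliceLeft_t₁_symm hε a x c
  have hJt : ∀ c y p, J c (y ⊗ₜ p) = y * G (p ⊗ₜ c) := fun c y p => by simp [J]
  have key : ∀ (b c : A) (w : A ⊗[ℂ] A), J c ((Δ b).rmul w) = ε b • J c w := by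
    intro b c w
    obtain ⟨z, rfl⟩ := T₂.surjective w
    induction z with
    | zero => simp
    | add x y hx hy => simp only [map_add, smul_add, hx, hy]
    | tmul a x => rw [← h.t₂_mul, hJ, hJ, map_mul, smul_smul, mul_comm]
  -- On w = (x ⊗ 1)Δ(b), left multiplication by 1 ⊗ p gives (x ⊗ p)Δ(b), so both sides are ε(b) x
  -- G(p ⊗ c).
  have key₂ : ∀ w : A ⊗[ℂ] A, J c ((inr A p).lmul w) = J (G (p ⊗ₜ c)) w := by
    intro w
    obtain ⟨z, rfl⟩ := T₂.surjective w
    induction z with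
    | zero => simp
    | add x y hx hy => simp only [map_add, hx, hy]
    | tmul b x => rw [← h.comul_rmul_tmul, key, hJt, hJ]
  change G _ = G (q ⊗ₜ G (p ⊗ₜ c))
  refine sub_eq_zero.1 (h.nondeg.2 _ fun y => ?_)
  rw [mul_sub, ← hJt, ← hJt, ← key₂, inr_lmul_tmul, sub_self]

/-- `S(a) c = (ε ⊙ ι)T₁⁻¹(a ⊗ c)`. -/
theorem antipode_mul_eq {S : A ≃ₗ[ℂ] A}
    (hS : ∀ w, sliceLeft A (ε : A →ₗ[ℂ] ℂ) (T₁.symm (T₃ w)) =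
      S (sliceLeft A (ε : A →ₗ[ℂ] ℂ) w)) (a c : A) :
    S a * c = sliceLeft A (ε : A →ₗ[ℂ] ℂ) (T₁.symm (a ⊗ₜ c)) := by
  have g₁ : ∀ w, S a * sliceLeft A (ε : A →ₗ[ℂ] ℂ) w =
      sliceLeft A (ε : A →ₗ[ℂ] ℂ) (T₁.symm ((inl A a).rmul (T₁ w))) := by
    intro w
    induction w with
    | zero => simp
    | add x y hx hy => simp only [map_add, mul_add, hx, hy]
    | tmul b c =>
      have := hS (b ⊗ₜ a)
      rw [sliceLeft_tmul, map_smul] at this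
      rw [sliceLeft_tmul, mul_smul_comm, ← smul_mul_assoc, ← this, ← sliceLeft_inr_rmul,
        ← h.t₁_symm_inr_rmul, h.inr_rmul_t₃]
  have g₂ : ∀ w, S a * sliceLeft A (ε : A →ₗ[ℂ] ℂ) (T₁.symm w) =
      sliceLeft A (ε : A →ₗ[ℂ] ℂ)
        (T₁.symm (a ⊗ₜ sliceLeft A (ε : A →ₗ[ℂ] ℂ) (T₁.symm w))) := by
    intro w
    rw [g₁, LinearEquiv.apply_symm_apply]
    induction w with
    | zero => simp
    | add x y hx hy => simp only [map_add, TensorProduct.tmul_add, hx, hy]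
    | tmul p q => rw [inl_rmul_tmul, h.sliceLeft_t₁_symm_mul hε]
  obtain ⟨b₀, hb₀⟩ := hε.exists_eq_one
  have hb : sliceLeft A (ε : A →ₗ[ℂ] ℂ) (T₁.symm (T₁ (b₀ ⊗ₜ c))) = c := by
    rw [LinearEquiv.symm_apply_apply, sliceLeft_tmul]
    change ε b₀ • c = c
    rw [hb₀, one_smul]
  rw [← hb, g₂]

end Counit

/-- The choice defining `counit` falls back to 0 if no counit exists; existence rules this out. -/
theorem counit_isCounit {φ : Module.Dual ℂ A} (hφ : IsLeftHaar Δ φ) : IsCounit Δ (counit Δ) := by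
  have hex := h.exists_isCounit hφ.exists_ne_zero
  rw [counit, dif_pos hex]
  exact hex.choose_spec

theorem antipode_isAntipode {φ : Module.Dual ℂ A} (hφ : IsLeftHaar Δ φ) :
    IsAntipode Δ (antipode Δ) := by
  have hex : ∃ S, IsAntipode Δ S := by
    have hε := h.counit_isCounit hφ
    obtain ⟨S, hS⟩ := h.exists_antipode_equiv hε hφ
    have hG := h.antipode_mul_eq hε hS
    refine ⟨S, fun a b => sub_eq_zero.1 (h.nondeg.1 _ fun c => ?_),
      fun a b => ⟨_, h.t₁ a b, ?_⟩, fun a b => ⟨_, h.t₂ a b, ?_⟩⟩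
    · rw [sub_mul, hG, h.sliceLeft_t₁_symm_mul hε, ← hG, ← hG, mul_assoc, sub_self]
    · have : ∀ w, LinearMap.mul' ℂ A (S.toLinearMap.rTensor A w) =
          sliceLeft A (counit Δ : A →ₗ[ℂ] ℂ) (T₁.symm w) := by
        intro w
        induction w with
        | zero => simp
        | add x y hx hy => simp only [map_add, hx, hy]
        | tmul p q => simp [hG]
      rw [this, LinearEquiv.symm_apply_apply, sliceLeft_tmul]
      rfl
    · refine sub_eq_zero.1 (h.nondeg.1 _ fun c => ?_)
      have : ∀ w, LinearMap.mul' ℂ A (S.toLinearMap.lTensor A w) * c =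
          LinearMap.mul' ℂ A ((sliceLeft A (counit Δ : A →ₗ[ℂ] ℂ) ∘ₗ
            T₁.symm.toLinearMap).lTensor A (TensorProduct.assoc ℂ A A A (w ⊗ₜ c))) := by
        intro w
        induction w with
        | zero => simp
        | add x y hx hy => simp only [map_add, TensorProduct.add_tmul, add_mul, hx, hy]
        | tmul p q => simp [mul_assoc, hG]
      rw [sub_mul, this, h.mul_sliceLeft_t₁_symm hε, smul_mul_assoc, sub_self]
  rw [antipode, dif_pos hex]
  exact hex.choose_spec

end IsGaloisMaps

end Antipode

/-! ### Hopf identities for the antipode, and its action on the Haar functional -/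

section AntipodeIdentities

variable {A : Type*} [NonUnitalRing A] [Module ℂ A] [IsScalarTower ℂ A A] [SMulCommClass ℂ A A]
variable {Δ : A →ₙₐ[ℂ] Mult (A ⊗[ℂ] A)} {T₁ T₂ T₃ T₄ : A ⊗[ℂ] A ≃ₗ[ℂ] A ⊗[ℂ] A}

theorem inr_rmul_cancel {B : Type*} [NonUnitalRing B] [Module ℂ B] [IsScalarTower ℂ B B]
    [SMulCommClass ℂ B B] (hA : IsNondegenerateAlg A) (hB : IsNondegenerateAlg B)
    {z w : A ⊗[ℂ] B} (hzw : ∀ e, (inr A e).rmul z = (inr A e).rmul w) : z = w := by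
  refine sub_eq_zero.1 ((isNondegenerateAlg_tensor hA hB).1 _ fun t => ?_)
  induction t with
  | zero => simp
  | add x y hx hy => rw [mul_add, hx, hy, add_zero]
  | tmul x e =>
    have : ∀ u : A ⊗[ℂ] B, u * x ⊗ₜ e = (inl B x).rmul ((inr A e).rmul u) := fun u => by
      rw [← mul_rmul, inr_mul_inl, incl_rmul]
    rw [this, map_sub, hzw, sub_self, map_zero]

theorem inr_lmul_cancel {B : Type*} [NonUnitalRing B] [Module ℂ B] [IsScalarTower ℂ B B]
    [SMulCommClass ℂ B B] (hA : IsNondegenerateAlg A) (hB : IsNondegenerateAlg B)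
    {z w : A ⊗[ℂ] B} (hzw : ∀ e, (inr A e).lmul z = (inr A e).lmul w) : z = w := by
  refine sub_eq_zero.1 ((isNondegenerateAlg_tensor hA hB).2 _ fun t => ?_)
  induction t with
  | zero => simp
  | add x y hx hy => rw [add_mul, hx, hy, add_zero]
  | tmul x e =>
    have : ∀ u : A ⊗[ℂ] B, x ⊗ₜ e * u = (inl B x).lmul ((inr A e).lmul u) := fun u => by
      rw [← mul_lmul, inl_mul_inr, incl_lmul]
    rw [this, map_sub, hzw, sub_self, map_zero]

/-- The map `x ⊗ (u ⊗ v) ↦ S(x)u ⊗ v`. -/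
def antipodeMul (S : A ≃ₗ[ℂ] A) : A ⊗[ℂ] (A ⊗[ℂ] A) →ₗ[ℂ] A ⊗[ℂ] A :=
  (LinearMap.mul' ℂ A ∘ₗ S.toLinearMap.rTensor A).rTensor A ∘ₗ
    (TensorProduct.assoc ℂ A A A).symm.toLinearMap

@[simp] theorem antipodeMul_tmul (S : A ≃ₗ[ℂ] A) (x u v : A) :
    antipodeMul S (x ⊗ₜ (u ⊗ₜ v)) = (S x * u) ⊗ₜ v := by simp [antipodeMul]

theorem antipodeMul_assoc (S : A ≃ₗ[ℂ] A) (w : A ⊗[ℂ] A) (v : A) :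
    antipodeMul S (TensorProduct.assoc ℂ A A A (w ⊗ₜ v)) =
      LinearMap.mul' ℂ A (S.toLinearMap.rTensor A w) ⊗ₜ v := by
  simp [antipodeMul]

theorem antipodeMul_tmul_eq (S : A ≃ₗ[ℂ] A) (x : A) (w : A ⊗[ℂ] A) :
    antipodeMul S (x ⊗ₜ w) = (inl A (S x)).lmul w := by
  induction w with
  | zero => simp
  | add x y hx hy => simp only [map_add, TensorProduct.tmul_add, hx, hy]
  | tmul u v => simp

/-- The map `a ⊗ b ↦ S(b) ⊗ S(a)`. -/
def antipodeFlip (S : A ≃ₗ[ℂ] A) : A ⊗[ℂ] A →ₗ[ℂ] A ⊗[ℂ] A :=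
  TensorProduct.map S.toLinearMap S.toLinearMap ∘ₗ (TensorProduct.comm ℂ A A).toLinearMap

@[simp] theorem antipodeFlip_tmul (S : A ≃ₗ[ℂ] A) (a b : A) :
    antipodeFlip S (a ⊗ₜ b) = S b ⊗ₜ S a := by simp [antipodeFlip]

theorem sliceRight_antipodeFlip (S : A ≃ₗ[ℂ] A) (φ : Module.Dual ℂ A) (w : A ⊗[ℂ] A) :
    sliceRight A φ (antipodeFlip S w) = S (sliceLeft A (φ ∘ₗ S.toLinearMap) w) := by
  induction w with
  | zero => simp
  | add x y hx hy => simp only [map_add, hx, hy]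
  | tmul a b => simp

namespace IsAntipode

variable {S : A ≃ₗ[ℂ] A} (hS : IsAntipode Δ S)

include hS

theorem inr_rmul_antipodeFlip (v : A) (w : A ⊗[ℂ] A) :
    (inr A (S v)).rmul (antipodeFlip S w) = antipodeFlip S ((inl A v).lmul w) := by
  induction w with
  | zero => simp
  | add x y hx hy => simp only [map_add, hx, hy]
  | tmul a b => simp [hS.map_mul]

theorem inr_lmul_antipodeFlip (v : A) (w : A ⊗[ℂ] A) :
    (inr A (S v)).lmul (antipodeFlip S w) = antipodeFlip S ((inl A v).rmul w) := by
  induction w with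
  | zero => simp
  | add x y hx hy => simp only [map_add, hx, hy]
  | tmul a b => simp [hS.map_mul]

theorem mul_rTensor_inl_rmul (q : A) (z : A ⊗[ℂ] A) :
    LinearMap.mul' ℂ A (S.toLinearMap.rTensor A ((inl A q).rmul z)) =
      S q * LinearMap.mul' ℂ A (S.toLinearMap.rTensor A z) := by
  induction z with
  | zero => simp
  | add x y hx hy => simp only [map_add, mul_add, hx, hy]
  | tmul a b => simp [hS.map_mul, mul_assoc]

end IsAntipode

namespace IsGaloisMaps

variable (h : IsGaloisMaps Δ T₁ T₂ T₃ T₄)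
  {S : A ≃ₗ[ℂ] A} (hS : IsAntipode Δ S)

include h hS

theorem antipode_t₁ (a b : A) :
    LinearMap.mul' ℂ A (S.toLinearMap.rTensor A (T₁ (a ⊗ₜ b))) = counit Δ a • b := by
  obtain ⟨x, hx, hx'⟩ := hS.left a b
  rw [h.inj ((h.t₁ a b).trans hx.symm), ← hx']

variable (hε : IsCounit Δ (counit Δ))

include hε

/-- `(S(x) ⊗ 1)Δ(a)(d ⊗ 1) = S(q)d ⊗ p` for `x ⊗ a = Δ(p)(q ⊗ 1)`. -/
theorem antipodeMul_t₃ (p q d : A) :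
    antipodeMul S ((fixRight T₃ d).lTensor A (T₃ (p ⊗ₜ q))) = (S q * d) ⊗ₜ p := by
  -- In Sweedler notation the claim is S(p₁q)p₂d ⊗ p₃ = S(q)d ⊗ p. The leg p₃ must be covered, by 1
  -- ⊗ e, before coassociativity and the antipode axiom can be used.
  refine inr_rmul_cancel h.nondeg h.nondeg fun e => ?_
  have h₁ : ∀ z, (inr A e).rmul (antipodeMul S ((fixRight T₃ d).lTensor A z)) =
      antipodeMul S ((inl A d).rmul.lTensor A ((fixRight T₁ e).lTensor A z)) := by
    intro z
    induction z with
    | zero => simp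
    | add x y hx hy => simp only [map_add, hx, hy]
    | tmul x a =>
      simp only [LinearMap.lTensor_tmul, fixRight_apply]
      rw [← h.inr_rmul_t₃, antipodeMul_tmul_eq, antipodeMul_tmul_eq]
      induction T₃ (a ⊗ₜ d) with
      | zero => simp
      | add x y hx hy => simp only [map_add, hx, hy]
      | tmul u v => simp
  have h₂ : ∀ w : A ⊗[ℂ] A, antipodeMul S ((inl A d).rmul.lTensor A
      (TensorProduct.assoc ℂ A A A ((fixRight T₃ q).rTensor A w))) =
      (S q * d) ⊗ₜ sliceLeft A (counit Δ : A →ₗ[ℂ] ℂ) w := by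
    intro w
    induction w with
    | zero => simp
    | add x y hx hy => simp only [map_add, TensorProduct.tmul_add, hx, hy]
    | tmul r s =>
      have h₃ : ∀ t : A ⊗[ℂ] A, (inl A d).rmul.lTensor A (TensorProduct.assoc ℂ A A A (t ⊗ₜ s)) =
          TensorProduct.assoc ℂ A A A ((inr A d).rmul t ⊗ₜ s) := by
        intro t
        induction t with
        | zero => simp
        | add x y hx hy => simp only [map_add, TensorProduct.add_tmul, hx, hy]
        | tmul u v => simp
      rw [LinearMap.rTensor_tmul, fixRight_apply, h₃, h.inr_rmul_t₃, antipodeMul_assoc,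
        hS.mul_rTensor_inl_rmul, h.antipode_t₁ hS, mul_smul_comm, sliceLeft_tmul,
        TensorProduct.smul_tmul]
      rfl
  rw [h₁, ← h.coassoc₃₁, h₂, h.counit_t₁ hε, inr_rmul_tmul]

/-- The identity S(b₁)b₂p ⊗ b₃q = p ⊗ bq, with the legs covered by z = p ⊗ q. -/
theorem antipodeMul_doubleComulMul (b : A) (z : A ⊗[ℂ] A) :
    antipodeMul S (doubleComulMul T₁ b z) = (inr A b).lmul z := by
  induction z with
  | zero => simp
  | add x y hx hy => simp only [map_add, hx, hy]
  | tmul p q =>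
    have h₂ : ∀ w : A ⊗[ℂ] A, antipodeMul S
        (TensorProduct.assoc ℂ A A A ((fixRight T₁ p).rTensor A w)) =
        p ⊗ₜ sliceLeft A (counit Δ : A →ₗ[ℂ] ℂ) w := by
      intro w
      induction w with
      | zero => simp
      | add x y hx hy => simp only [map_add, TensorProduct.tmul_add, hx, hy]
      | tmul r s =>
        rw [LinearMap.rTensor_tmul, fixRight_apply, antipodeMul_assoc, h.antipode_t₁ hS,
          sliceLeft_tmul, TensorProduct.smul_tmul]
        rfl
    rw [doubleComulMul_tmul, h₂, h.counit_t₁ hε, inr_lmul_tmul]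

/-- Strong left invariance: `S((ι ⊙ φ)(Δ(b)(1 ⊗ x))) = (ι ⊙ φ)((1 ⊗ b)Δ(x))`. -/
theorem antipode_sliceRight_t₁ {φ : Module.Dual ℂ A} (hφ : IsLeftHaar Δ φ) (b x : A) :
    S (sliceRight A φ (T₁ (b ⊗ₜ x))) = sliceRight A φ (T₄ (x ⊗ₜ b)) := by
  refine sub_eq_zero.1 (h.nondeg.1 _ fun c => ?_)
  -- Left invariance replaces φ(s)c by (ι ⊙ φ)(Δ(s)(c ⊗ 1)); thus S(b₁)c φ(b₂x) = S(b₁)b₂x₁c φ(b₃x₂)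
  -- = x₁c φ(bx₂).
  have h₁ : ∀ w, S (sliceRight A φ w) * c =
      sliceRight A φ (antipodeMul S ((fixRight T₃ c).lTensor A w)) := by
    intro w
    induction w with
    | zero => simp
    | add x y hx hy => simp only [map_add, add_mul, hx, hy]
    | tmul r s =>
      rw [LinearMap.lTensor_tmul, fixRight_apply, antipodeMul_tmul_eq, sliceRight_inl_lmul,
        h.haar_t₃ hφ, sliceRight_tmul, map_smul, smul_mul_assoc, mul_smul_comm]
  rw [sub_mul, h₁, h.lTensor_t₁_of (inl A c) _ (fun s => h.t₃ s c),
    h.antipodeMul_doubleComulMul hS hε, fixRight_apply, h.inr_lmul_t₃, sliceRight_inl_rmul,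
    sub_self]

/-- `S(a₂)a₃c ⊗ S(a₁q)a₄d = ε(a)c ⊗ S(q)d`. -/
theorem antipodeFlip_mul_doubleComulMul (a q : A) (z : A ⊗[ℂ] A) :
    LinearMap.mul' ℂ (A ⊗[ℂ] A) ((antipodeFlip S ∘ₗ fixRight T₃ q).rTensor (A ⊗[ℂ] A)
      (doubleComulMul T₁ a z)) = counit Δ a • (inr A (S q)).lmul z := by
  induction z with
  | zero => simp
  | add x y hx hy => simp only [map_add, smul_add, hx, hy]
  | tmul c d =>
    -- R s sends x ⊗ (y ⊗ z) to S(y)z ⊗ S(x)s. It cancels the inner pair S(a₂)a₃ first, leaving the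
    -- outer pair for a second use of the antipode axiom.
    let R : A → A ⊗[ℂ] (A ⊗[ℂ] A) →ₗ[ℂ] A ⊗[ℂ] A := fun s =>
      TensorProduct.map (LinearMap.mul' ℂ A ∘ₗ S.toLinearMap.rTensor A)
        (LinearMap.mulRight ℂ s ∘ₗ S.toLinearMap) ∘ₗ
        (TensorProduct.comm ℂ A (A ⊗[ℂ] A)).toLinearMap
    have h₁ : ∀ (s : A) (w : A ⊗[ℂ] A),
        LinearMap.mul' ℂ (A ⊗[ℂ] A) ((antipodeFlip S ∘ₗ fixRight T₃ q).rTensor (A ⊗[ℂ] A)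
          (TensorProduct.assoc ℂ A A A (w ⊗ₜ s))) =
        R s (TensorProduct.assoc ℂ A A A ((fixRight T₃ q).rTensor A w)) := by
      intro s w
      induction w with
      | zero => simp
      | add x y hx hy => simp only [map_add, TensorProduct.add_tmul, hx, hy]
      | tmul u v =>
        simp only [TensorProduct.assoc_tmul, LinearMap.rTensor_tmul, LinearMap.comp_apply,
          fixRight_apply, LinearMap.mul'_apply]
        induction T₃ (u ⊗ₜ q) with
        | zero => simp
        | add x y hx hy => simp only [map_add, TensorProduct.add_tmul, add_mul, hx, hy]
        | tmul g k => simp [R]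
    have h₂ : ∀ (s : A) (t : A ⊗[ℂ] A), R s ((fixRight T₁ c).lTensor A t) =
        c ⊗ₜ (S (sliceRight A (counit Δ : A →ₗ[ℂ] ℂ) t) * s) := by
      intro s t
      induction t with
      | zero => simp
      | add x y hx hy => simp only [map_add, add_mul, TensorProduct.tmul_add, hx, hy]
      | tmul g k =>
        have : R s (g ⊗ₜ T₁ (k ⊗ₜ c)) =
            LinearMap.mul' ℂ A (S.toLinearMap.rTensor A (T₁ (k ⊗ₜ c))) ⊗ₜ (S g * s) := by
          simp [R]
        rw [LinearMap.lTensor_tmul, fixRight_apply, this, h.antipode_t₁ hS, sliceRight_tmul,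
          map_smul, smul_mul_assoc, TensorProduct.smul_tmul]
        rfl
    have h₃ : ∀ w : A ⊗[ℂ] A,
        LinearMap.mul' ℂ (A ⊗[ℂ] A) ((antipodeFlip S ∘ₗ fixRight T₃ q).rTensor (A ⊗[ℂ] A)
          (TensorProduct.assoc ℂ A A A ((fixRight T₁ c).rTensor A w))) =
        c ⊗ₜ (S q * LinearMap.mul' ℂ A (S.toLinearMap.rTensor A w)) := by
      intro w
      induction w with
      | zero => simp
      | add x y hx hy => simp only [map_add, mul_add, TensorProduct.tmul_add, hx, hy]
      | tmul r s =>
        rw [LinearMap.rTensor_tmul, fixRight_apply, h₁, h.coassoc₃₁, h₂, h.counit_t₃ hε,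
          hS.map_mul, mul_assoc]
        simp
    rw [doubleComulMul_tmul, h₃, h.antipode_t₁ hS, inr_lmul_tmul, mul_smul_comm,
      TensorProduct.tmul_smul]

/-- `(1 ⊗ S(q))Δ(S(u)) = (S ⊙ S)σ(Δ(u)(q ⊗ 1))`. -/
theorem t₄_antipode (u q : A) : T₄ (S u ⊗ₜ S q) = antipodeFlip S (T₃ (u ⊗ₜ q)) := by
  -- Both Δ ∘ S and (S ⊙ S)σΔ are convolution inverses of Δ. The comparison is made against Δ(v)z at
  -- w = u ⊗ v, writing w as T₁ of something, where each side reduces to ε(a)(1 ⊗ S(q))Δ(b)z.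
  have key : ∀ (z w : A ⊗[ℂ] A),
      LinearMap.mul' ℂ (A ⊗[ℂ] A) (TensorProduct.map
        (fixRight T₄ (S q) ∘ₗ S.toLinearMap) (comulMulRight Δ z) w) =
      LinearMap.mul' ℂ (A ⊗[ℂ] A) (TensorProduct.map
        (antipodeFlip S ∘ₗ fixRight T₃ q) (comulMulRight Δ z) w) := by
    intro z w
    have h₁ : LinearMap.mul' ℂ (A ⊗[ℂ] A) (TensorProduct.map
        (fixRight T₄ (S q) ∘ₗ S.toLinearMap) (comulMulRight Δ z) w) =
        (inr A (S q)).lmul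
          ((Δ (LinearMap.mul' ℂ A (S.toLinearMap.rTensor A w))).lmul z) := by
      change _ = (inr A (S q)).lmul (comulMulRight Δ z _)
      induction w with
      | zero => simp
      | add x y hx hy => simp only [map_add, hx, hy]
      | tmul a b =>
        simp only [TensorProduct.map_tmul, LinearMap.comp_apply, LinearMap.rTensor_tmul,
          LinearMap.mul'_apply, fixRight_apply, LinearEquiv.coe_coe]
        change T₄ (S a ⊗ₜ S q) * (Δ b).lmul z = (inr A (S q)).lmul ((Δ (S a * b)).lmul z)
        rw [map_mul, mul_lmul, ← mul_lmul, ← h.t₄, incl_lmul]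
    rw [h₁]
    clear h₁
    obtain ⟨y, rfl⟩ := T₁.surjective w
    change (inr A (S q)).lmul (comulMulRight Δ z _) = _
    induction y with
    | zero => simp
    | add x y hx hy => simp only [map_add, hx, hy]
    | tmul a b =>
      have h₂ : TensorProduct.map (antipodeFlip S ∘ₗ fixRight T₃ q) (comulMulRight Δ z)
          (T₁ (a ⊗ₜ b)) = (antipodeFlip S ∘ₗ fixRight T₃ q).rTensor (A ⊗[ℂ] A)
            ((comulMulRight Δ z).lTensor A (T₁ (a ⊗ₜ b))) := by
        rw [← LinearMap.comp_apply, LinearMap.rTensor_comp_lTensor]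
      rw [h₂, h.lTensor_t₁_of (incl (A ⊗[ℂ] A) z) _ (fun s => (mul_incl _ _).symm),
        h.antipodeFlip_mul_doubleComulMul hS hε, h.antipode_t₁ hS, map_smul, map_smul]
  refine sub_eq_zero.1 (h.nondeg₂.1 _ fun y => ?_)
  have hy : y ∈ Submodule.span ℂ {d | ∃ c d', d = (Δ c).lmul d'} :=
    h.regular.comul_nondegenerate.1 ▸ trivial
  induction hy using Submodule.span_induction with
  | zero => simp
  | add x y _ _ hx hy => rw [mul_add, hx, hy, add_zero]
  | smul r x _ hx => rw [mul_smul_comm, hx, smul_zero]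
  | mem x hx =>
    obtain ⟨v, z, rfl⟩ := hx
    have := key z (u ⊗ₜ v)
    rw [sub_mul, sub_eq_zero]
    exact this

/-- `Δ(S(u))(1 ⊗ S(v)) = (S ⊙ S)σ((v ⊗ 1)Δ(u))`. -/
theorem t₁_antipode (u v : A) : T₁ (S u ⊗ₜ S v) = antipodeFlip S (T₂ (u ⊗ₜ v)) := by
  refine inr_lmul_cancel h.nondeg h.nondeg fun e => ?_
  obtain ⟨q, rfl⟩ := S.surjective e
  rw [h.inr_lmul_t₁, h.t₄_antipode hS hε, hS.inr_rmul_antipodeFlip, h.inl_lmul_t₃,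
    hS.inr_lmul_antipodeFlip]

/-- Strong right invariance of φ ∘ S: the antipode reverses the legs of Δ, so this is strong left
invariance of φ transported by S. -/
theorem sliceLeft_t₃ {φ : Module.Dual ℂ A} (hφ : IsLeftHaar Δ φ) (v u : A) :
    sliceLeft A (φ ∘ₗ S.toLinearMap) (T₃ (v ⊗ₜ u)) =
      S (sliceLeft A (φ ∘ₗ S.toLinearMap) (T₂ (u ⊗ₜ v))) := by
  apply S.injective
  rw [← sliceRight_antipodeFlip, ← sliceRight_antipodeFlip, ← h.t₁_antipode hS hε,
    ← h.t₄_antipode hS hε, h.antipode_sliceRight_t₁ hS hε hφ]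

/-- Both sides compute ψ((ι ⊙ φ)((1 ⊗ S(b))Δ(x)) S(a)), where ψ = φ ∘ S: once through strong left
invariance of φ, once through strong right invariance of ψ. This takes the place of an explicit
modular element relating φ and ψ. -/
theorem haar_mul_eq {φ : Module.Dual ℂ A} (hφ : IsLeftHaar Δ φ) (a b x : A) :
    φ (sliceLeft A ((φ ∘ₗ S.toLinearMap) ∘ₗ S.toLinearMap) (T₂ (S b ⊗ₜ a)) * x) =
      φ (S (x * sliceRight A (φ ∘ₗ S.toLinearMap) (T₁ (S a ⊗ₜ b)))) := by
  set ψ := φ ∘ₗ S.toLinearMap with hψ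
  have hψa : ∀ y, φ (S y) = ψ y := fun _ => rfl
  have e₁ : ψ (sliceRight A φ (T₄ (x ⊗ₜ S b)) * S a) =
      φ (sliceLeft A (ψ ∘ₗ S.toLinearMap) (T₂ (S b ⊗ₜ a)) * x) := by
    rw [← sliceLeft_inr_rmul, ← h.inl_lmul_t₁, ← h.antipode_sliceRight_t₁ hS hε hφ,
      ← hS.map_mul, sliceLeft_inl_lmul, map_sliceLeft]
    rfl
  have e₂ : ψ (sliceRight A φ (T₄ (x ⊗ₜ S b)) * S a) =
      φ (S (x * sliceRight A ψ (T₁ (S a ⊗ₜ b)))) := by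
    rw [← sliceRight_inl_rmul, ← h.inr_lmul_t₃, ← map_sliceLeft, sliceLeft_inr_lmul,
      h.sliceLeft_t₃ hS hε hφ, ← hS.map_mul, hψa, hψa, ← sliceLeft_inr_rmul, ← h.inl_lmul_t₁,
      map_sliceLeft, sliceRight_inl_lmul]
  rw [← e₁, e₂]

theorem exists_haar_antipode_eq {φ : Module.Dual ℂ A} (hφ : IsLeftHaar Δ φ) (c : A) :
    ∃ b, ∀ x, φ (S (x * c)) = φ (b * x) := by
  obtain ⟨p, hp⟩ : ∃ p, φ p ≠ 0 := not_forall.1 fun h0 => hφ.ne_zero (LinearMap.ext h0)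
  -- Every c is a slice (ι ⊙ φS)(T₁ w), because T₁ is onto and φ ∘ S is non-zero; it remains to
  -- treat elementary w with `haar_mul_eq`.
  obtain ⟨w, hw⟩ : ∃ w, sliceRight A (φ ∘ₗ S.toLinearMap) (T₁ w) = c :=
    ⟨T₁.symm (c ⊗ₜ ((φ p)⁻¹ • S.symm p)), by simp [smul_smul, hp]⟩
  rw [← hw]
  clear hw
  induction w with
  | zero => exact ⟨0, fun x => by simp⟩
  | add x y hx hy =>
    obtain ⟨b, hb⟩ := hx
    obtain ⟨b', hb'⟩ := hy
    exact ⟨b + b', fun x => by simp only [map_add, mul_add, add_mul, hb, hb']⟩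
  | tmul a b =>
    obtain ⟨a', rfl⟩ := S.surjective a
    exact ⟨_, fun x => (h.haar_mul_eq hS hε hφ a' b x).symm⟩

theorem exists_haar_eq_antipode {φ : Module.Dual ℂ A} (hφ : IsLeftHaar Δ φ) (b : A) :
    ∃ c, ∀ x, φ (b * x) = φ (S (x * c)) := by
  obtain ⟨p, hp⟩ : ∃ p, φ p ≠ 0 := not_forall.1 fun h0 => hφ.ne_zero (LinearMap.ext h0)
  -- Likewise every b is a slice of some T₂ w; the factor S⁻²(p) makes φ ∘ S² equal to φ(p) there.
  obtain ⟨w, hw⟩ : ∃ w, sliceLeft A ((φ ∘ₗ S.toLinearMap) ∘ₗ S.toLinearMap) (T₂ w) = b :=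
    ⟨T₂.symm (((φ p)⁻¹ • S.symm (S.symm p)) ⊗ₜ b), by simp [hp]⟩
  rw [← hw]
  clear hw
  induction w with
  | zero => exact ⟨0, fun x => by simp⟩
  | add x y hx hy =>
    obtain ⟨b, hb⟩ := hx
    obtain ⟨b', hb'⟩ := hy
    exact ⟨b + b', fun x => by simp only [map_add, mul_add, add_mul, hb, hb']⟩
  | tmul b a =>
    obtain ⟨b', rfl⟩ := S.surjective b
    exact ⟨_, fun x => h.haar_mul_eq hS hε hφ a b' x⟩

end IsGaloisMaps

end AntipodeIdentities

/-! ### Corepresentations: the inverse, and slices -/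

section Corepresentations

variable {A : Type*} [NonUnitalRing A] [Module ℂ A] [IsScalarTower ℂ A A] [SMulCommClass ℂ A A]
variable {B : Type*} [NonUnitalRing B] [Module ℂ B] [IsScalarTower ℂ B B] [SMulCommClass ℂ B B]
variable {Δ : A →ₙₐ[ℂ] Mult (A ⊗[ℂ] A)} {T₁ T₂ T₃ T₄ : A ⊗[ℂ] A ≃ₗ[ℂ] A ⊗[ℂ] A}

namespace Mult

theorem lmul_rmul_comm (hA : IsNondegenerateAlg A) (m n : Mult A) (z : A) :
    m.lmul (n.rmul z) = n.rmul (m.lmul z) :=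
  sub_eq_zero.1 (hA.1 _ fun w => by
    rw [sub_mul, ← lmul_apply_mul, rmul_mul, rmul_mul, lmul_apply_mul, sub_self])

theorem mul_inr_cancel (hA : IsNondegenerateAlg A) (hB : IsNondegenerateAlg B)
    {m n : Mult (A ⊗[ℂ] B)} (hmn : ∀ b, m * inr A b = n * inr A b) : m = n := by
  have hAB := isNondegenerateAlg_tensor hA hB
  refine ext_lmul hAB fun w => ?_
  induction w with
  | zero => simp
  | add x y hx hy => simp only [map_add, hx, hy]
  | tmul a b =>
    apply incl_injective hAB
    rw [← mul_incl, ← mul_incl, ← inr_mul_inl, ← mul_assoc, ← mul_assoc, hmn]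

theorem inl_mul_cancel (hA : IsNondegenerateAlg A) (hB : IsNondegenerateAlg B)
    {m n : Mult (A ⊗[ℂ] B)} (hmn : ∀ a, inl B a * m = inl B a * n) : m = n := by
  have hAB := isNondegenerateAlg_tensor hA hB
  refine ext_rmul hAB fun w => ?_
  induction w with
  | zero => simp
  | add x y hx hy => simp only [map_add, hx, hy]
  | tmul a b =>
    apply incl_injective hAB
    rw [← incl_mul, ← incl_mul, ← inr_mul_inl, mul_assoc, mul_assoc, hmn]

theorem leg23_lmul_tmul (V : Mult (A ⊗[ℂ] B)) (x a : A) (b : B) :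
    (leg23 V).lmul ((x ⊗ₜ a) ⊗ₜ b) = assocEquiv A A B (x ⊗ₜ V.lmul (a ⊗ₜ b)) := rfl

theorem leg13_lmul_tmul (V : Mult (A ⊗[ℂ] B)) (x a : A) (b : B) :
    (leg13 V).lmul ((x ⊗ₜ a) ⊗ₜ b) = leftCommEquiv A A B (a ⊗ₜ V.lmul (x ⊗ₜ b)) := rfl

theorem slice_leg13_leg23 (φ : Module.Dual ℂ A) (V : Mult (A ⊗[ℂ] B)) (x a : A) (b : B) :
    (sliceRight A φ).rTensor B ((leg13 V * leg23 V).lmul ((x ⊗ₜ a) ⊗ₜ b)) =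
      V.lmul (x ⊗ₜ sliceLeft B φ (V.lmul (a ⊗ₜ b))) := by
  rw [mul_lmul, leg23_lmul_tmul]
  induction V.lmul (a ⊗ₜ b) with
  | zero => simp
  | add y z hy hz => simp only [map_add, TensorProduct.tmul_add, hy, hz]
  | tmul c d =>
    change (sliceRight A φ).rTensor B ((leg13 V).lmul ((x ⊗ₜ c) ⊗ₜ d)) = _
    rw [leg13_lmul_tmul, sliceLeft_tmul, TensorProduct.tmul_smul, map_smul]
    induction V.lmul (x ⊗ₜ d) with
    | zero => simp
    | add y z hy hz => simp only [map_add, TensorProduct.tmul_add, smul_add, hy, hz]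
    | tmul u v => simp [leftCommEquiv, TensorProduct.smul_tmul']

end Mult

/-- The map `y ↦ (φ ⊙ ι)(V(y ⊗ b))`. -/
def sliceMap (φ : Module.Dual ℂ A) (V : Mult (A ⊗[ℂ] B)) (b : B) : A →ₗ[ℂ] B :=
  sliceLeft B φ ∘ₗ V.lmul ∘ₗ (TensorProduct.mk ℂ A B).flip b

@[simp] theorem sliceMap_apply (φ : Module.Dual ℂ A) (V : Mult (A ⊗[ℂ] B)) (b : B) (y : A) :
    sliceMap φ V b y = sliceLeft B φ (V.lmul (y ⊗ₜ b)) := rfl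

theorem lact_apply (a : A) (θ : Module.Dual ℂ A) (x : A) : lact a θ x = θ (x * a) := rfl

namespace IsGaloisMaps

variable (h : IsGaloisMaps Δ T₁ T₂ T₃ T₄)

include h

/-- (Δ ⊙ ι)(V) acts on Δ(p)(q ⊗ 1) ⊗ b as (Δ ⊙ ι)(V(p ⊗ b)) times q ⊗ 1 ⊗ 1, by the defining
property of the extension. -/
theorem corepresentation_t₃ (hB : IsNondegenerateAlg B) {V : Mult (A ⊗[ℂ] B)}
    (hV : IsCorepresentation Δ V) (p q : A) (b : B) :
    (leg13 V * leg23 V).lmul (T₃ (p ⊗ₜ q) ⊗ₜ b) = (fixRight T₃ q).rTensor B (V.lmul (p ⊗ₜ b)) := by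
  have hex := (existsUnique_extension_tensor_id h.nondeg₂ hB Δ
    h.regular.comul_nondegenerate V).exists
  have hE : IsExtensionAt (tensorHom (Δ : A →ₗ[ℂ] Mult (A ⊗[ℂ] A)) (incl B : B →ₗ[ℂ] Mult B)) V
      (leg13 V * leg23 V) := by
    rw [← hV, extend, dif_pos hex]
    exact hex.choose_spec
  apply incl_injective (isNondegenerateAlg_tensor h.nondeg₂ hB)
  rw [← tensorHom_left_mul_of (Δ : A →ₗ[ℂ] Mult (A ⊗[ℂ] A)) (inl A q) (fixRight T₃ q)
      (fun s => h.t₃ s q),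
    ← (hE _).1, mul_assoc,
    tensorHom_left_mul_of (Δ : A →ₗ[ℂ] Mult (A ⊗[ℂ] A)) (inl A q) (fixRight T₃ q)
      (fun s => h.t₃ s q), mul_incl]
  rfl

variable {φ : Module.Dual ℂ A} (hφ : IsLeftHaar Δ φ)

include hφ

/-- The central identity V · (ι ⊙ g)(Δ(p)(q ⊗ 1)) = q ⊗ g(p). It is the corepresentation equation
with φ applied to the second leg, left invariance absorbing Δ on the side of (Δ ⊙ ι)(V). -/
theorem lmul_sliceMap_t₃ (hB : IsNondegenerateAlg B) {V : Mult (A ⊗[ℂ] B)}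
    (hV : IsCorepresentation Δ V) (b : B) (t : A ⊗[ℂ] A) :
    V.lmul ((sliceMap φ V b).lTensor A (T₃ t)) =
      (sliceMap φ V b).lTensor A (TensorProduct.comm ℂ A A t) := by
  have h₁ : ∀ w : A ⊗[ℂ] A, V.lmul ((sliceMap φ V b).lTensor A w) =
      (sliceRight A φ).rTensor B ((leg13 V * leg23 V).lmul (w ⊗ₜ b)) := by
    intro w
    induction w with
    | zero => simp
    | add x y hx hy => simp only [map_add, TensorProduct.add_tmul, hx, hy]
    | tmul x a => rw [slice_leg13_leg23, LinearMap.lTensor_tmul, sliceMap_apply]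
  induction t with
  | zero => simp
  | add x y hx hy => simp only [map_add, hx, hy]
  | tmul p q =>
    rw [h₁, h.corepresentation_t₃ hB hV, TensorProduct.comm_tmul, LinearMap.lTensor_tmul,
      sliceMap_apply]
    induction V.lmul (p ⊗ₜ b) with
    | zero => simp
    | add x y hx hy => simp only [map_add, TensorProduct.tmul_add, hx, hy]
    | tmul u v =>
      rw [LinearMap.rTensor_tmul, LinearMap.rTensor_tmul, fixRight_apply, h.haar_t₃ hφ,
        sliceLeft_tmul, TensorProduct.smul_tmul]

/-- `(S⁻¹(a) ⊗ 1)V(1 ⊗ b)` lies in `A ⊙ B`, and is mapped by `S ⊙ ι` to `V⁻¹(a ⊗ b)`. -/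
theorem exists_inl_mul_corepresentation_mul_inr (hB : IsNondegenerateAlg B)
    (V : (Mult (A ⊗[ℂ] B))ˣ) (hV : IsCorepresentation Δ (V : Mult (A ⊗[ℂ] B))) (a : A) (b : B) :
    ∃ x, incl (A ⊗[ℂ] B) x =
        inl B ((antipode Δ).symm a) * (V : Mult (A ⊗[ℂ] B)) * inr A b ∧
      (antipode Δ).toLinearMap.rTensor B x =
        ((V⁻¹ : (Mult (A ⊗[ℂ] B))ˣ) : Mult (A ⊗[ℂ] B)).lmul (a ⊗ₜ b) := by
  have hS := h.antipode_isAntipode hφ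
  have hε := h.counit_isCounit hφ
  have hAB := isNondegenerateAlg_tensor h.nondeg hB
  set S := antipode Δ with hSdef
  have hVinv : ∀ w, (V : Mult (A ⊗[ℂ] B)).lmul
      (((V⁻¹ : (Mult (A ⊗[ℂ] B))ˣ) : Mult (A ⊗[ℂ] B)).lmul w) = w := fun w => by
    rw [← mul_lmul, Units.mul_inv, one_lmul]
  have hVinv' : ∀ w, ((V⁻¹ : (Mult (A ⊗[ℂ] B))ˣ) : Mult (A ⊗[ℂ] B)).lmul
      ((V : Mult (A ⊗[ℂ] B)).lmul w) = w := fun w => by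
    rw [← mul_lmul, Units.inv_mul, one_lmul]
  obtain ⟨p, hp⟩ : ∃ p, φ p ≠ 0 := not_forall.1 fun h0 => hφ.ne_zero (LinearMap.ext h0)
  -- Invertibility of V makes every b a slice (φ ⊙ ι)(V w): take w = V⁻¹(p' ⊗ b) with φ(p') = 1. By
  -- linearity only b = g(c) remains.
  obtain ⟨w, rfl⟩ : ∃ w, sliceLeft B φ ((V : Mult (A ⊗[ℂ] B)).lmul w) = b :=
    ⟨((V⁻¹ : (Mult (A ⊗[ℂ] B))ˣ) : Mult (A ⊗[ℂ] B)).lmul (((φ p)⁻¹ • p) ⊗ₜ b), by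
      rw [hVinv]; simp [hp]⟩
  induction w with
  | zero =>
    refine ⟨0, ?_, by simp⟩
    rw [map_zero, map_zero, map_zero, inr, map_zero]
    have : tmul (1 : Mult A) (0 : Mult B) = 0 := (tmulₗ A B 1).map_zero
    rw [this, mul_zero]
  | add x y hx hy =>
    obtain ⟨z, hz, hz'⟩ := hx
    obtain ⟨t, ht, ht'⟩ := hy
    refine ⟨z + t, ?_, by simp only [map_add, TensorProduct.tmul_add, hz', ht']⟩
    rw [map_add, hz, ht, ← mul_add, map_add, map_add]
    congr 1
    refine ((tmulₗ A B 1).map_add _ _).symm.trans ?_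
    rw [← map_add]
    rfl
  | tmul c b' =>
    set g := sliceMap φ (V : Mult (A ⊗[ℂ] B)) b' with hg
    change ∃ x, incl (A ⊗[ℂ] B) x = inl B (S.symm a) * (V : Mult (A ⊗[ℂ] B)) * inr A (g c) ∧
      S.toLinearMap.rTensor B x =
        ((V⁻¹ : (Mult (A ⊗[ℂ] B))ˣ) : Mult (A ⊗[ℂ] B)).lmul (a ⊗ₜ g c)
    have hK := h.lmul_sliceMap_t₃ hφ hB hV b'
    rw [← hg] at hK
    -- The central identity gives V⁻¹(a ⊗ g(c)) = (ι ⊙ g)(Δ(c)(a ⊗ 1)), so the required preimage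
    -- under S ⊙ ι is forced.
    refine ⟨g.lTensor A (S.symm.toLinearMap.rTensor A (T₃ (c ⊗ₜ a))), ?_, ?_⟩
    -- The central identity also expresses V(x ⊗ g(c)) through T₃⁻¹(x ⊗ c). What remains does not
    -- involve V, and after applying S to the first leg it is `antipodeMul_t₃`.
    · have hJ : ∀ x, (inl A (S.symm a)).lmul (TensorProduct.comm ℂ A A (T₃.symm (x ⊗ₜ c))) =
          (inl A x).rmul (S.symm.toLinearMap.rTensor A (T₃ (c ⊗ₜ a))) := by
        intro x
        apply (LinearEquiv.rTensor A S).injective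
        have h₁ : ∀ z : A ⊗[ℂ] A, LinearEquiv.rTensor A S
            ((inl A x).rmul (S.symm.toLinearMap.rTensor A z)) = (inl A (S x)).lmul z := by
          intro z
          induction z with
          | zero => simp
          | add x y hx hy => simp only [map_add, hx, hy]
          | tmul u v => simp [hS.map_mul]
        have h₂ : ∀ t : A ⊗[ℂ] A, LinearEquiv.rTensor A S
            ((inl A (S.symm a)).lmul (TensorProduct.comm ℂ A A t)) =
            antipodeMul S ((fixRight T₃ a).lTensor A (T₃ t)) := by
          intro t
          induction t with
          | zero => simp
          | add x y hx hy => simp only [map_add, hx, hy]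
          | tmul p q =>
            rw [h.antipodeMul_t₃ hS hε]
            simp [hS.map_mul]
        rw [h₁, h₂, LinearEquiv.apply_symm_apply, LinearMap.lTensor_tmul, fixRight_apply,
          antipodeMul_tmul_eq]
      refine ext_lmul hAB fun w => ?_
      induction w with
      | zero => simp
      | add x y hx hy => simp only [map_add, hx, hy]
      | tmul x y =>
        have h₃ : ∀ (d : A) (z : A ⊗[ℂ] A),
            (inl B d).lmul (g.lTensor A z) = g.lTensor A ((inl A d).lmul z) := by
          intro d z
          induction z with
          | zero => simp
          | add x y hx hy => simp only [map_add, hx, hy]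
          | tmul u v => simp
        have h₄ : ∀ (d : A) (z : A ⊗[ℂ] A),
            (inl B d).rmul (g.lTensor A z) = g.lTensor A ((inl A d).rmul z) := by
          intro d z
          induction z with
          | zero => simp
          | add x y hx hy => simp only [map_add, hx, hy]
          | tmul u v => simp
        have h₅ := hK (T₃.symm (x ⊗ₜ c))
        rw [LinearEquiv.apply_symm_apply, LinearMap.lTensor_tmul] at h₅
        have h₆ : ∀ u : A ⊗[ℂ] B, u * x ⊗ₜ y = (inr A y).rmul ((inl B x).rmul u) := fun u => by
          rw [← mul_rmul, inl_mul_inr, incl_rmul]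
        rw [incl_lmul, h₆, h₄, ← hJ, ← h₃, ← h₅, mul_lmul, mul_lmul, inr_lmul_tmul,
          ← inr_rmul_tmul, lmul_rmul_comm hAB, lmul_rmul_comm hAB]
    · have : ∀ z : A ⊗[ℂ] A, S.toLinearMap.rTensor B (g.lTensor A
          (S.symm.toLinearMap.rTensor A z)) = g.lTensor A z := by
        intro z
        induction z with
        | zero => simp
        | add x y hx hy => simp only [map_add, hx, hy]
        | tmul u v => simp
      rw [this, ← hVinv' (g.lTensor A (T₃ (c ⊗ₜ a))), hK]
      simp

/-- The left formula is already known. The right one follows from it, since the two actions of V⁻¹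
satisfy ((a ⊗ b)V⁻¹)(a' ⊗ b') = (a ⊗ b)(V⁻¹(a' ⊗ b')). -/
theorem isAntipodeTensorId_inv (hB : IsNondegenerateAlg B)
    (V : (Mult (A ⊗[ℂ] B))ˣ) (hV : IsCorepresentation Δ (V : Mult (A ⊗[ℂ] B))) :
    IsAntipodeTensorId (antipode Δ) (V : Mult (A ⊗[ℂ] B))
      ((V⁻¹ : (Mult (A ⊗[ℂ] B))ˣ) : Mult (A ⊗[ℂ] B)) := by
  have hS := h.antipode_isAntipode hφ
  have hAB := isNondegenerateAlg_tensor h.nondeg hB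
  have left := h.exists_inl_mul_corepresentation_mul_inr hφ hB V hV
  set S := antipode Δ with hSdef
  intro a b
  obtain ⟨x, hx, hx'⟩ := left a b
  refine ⟨⟨x, hx, hx'.symm⟩, S.symm.toLinearMap.rTensor B
    (((V⁻¹ : (Mult (A ⊗[ℂ] B))ˣ) : Mult (A ⊗[ℂ] B)).rmul (a ⊗ₜ b)), ?_, ?_⟩
  -- Multiplying by S⁻¹(a') ⊗ 1 on the left and 1 ⊗ b' on the right brings in the known element
  -- (S⁻¹(a') ⊗ 1)V(1 ⊗ b'). Applying S ⊙ ι then gives the compatibility of the actions of V⁻¹.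
  · refine inl_mul_cancel h.nondeg hB fun s => mul_inr_cancel h.nondeg hB fun b' => ?_
    obtain ⟨a', rfl⟩ := S.symm.surjective s
    obtain ⟨X, hX, hX'⟩ := left a' b'
    have e₁ : inl B (S.symm a') * (inr A b * (V : Mult (A ⊗[ℂ] B)) * inl B (S.symm a)) * inr A b' =
        inr A b * incl (A ⊗[ℂ] B) X * inl B (S.symm a) := by
      rw [hX]
      calc _ = inl B (S.symm a') * inr A b * (V : Mult (A ⊗[ℂ] B)) *
              (inl B (S.symm a) * inr A b') := by simp only [mul_assoc]
        _ = inr A b * inl B (S.symm a') * (V : Mult (A ⊗[ℂ] B)) *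
              (inr A b' * inl B (S.symm a)) := by
            rw [commute_inl_inr, commute_inl_inr]
        _ = _ := by simp only [mul_assoc]
    rw [e₁, mul_incl, mul_incl, incl_mul, incl_mul]
    congr 1
    apply (LinearEquiv.rTensor B S).injective
    have h₁ : ∀ (d : A) (z : A ⊗[ℂ] B), LinearEquiv.rTensor B S ((inl B (S.symm d)).rmul z) =
        (inl B d).lmul (LinearEquiv.rTensor B S z) := by
      intro d z
      induction z with
      | zero => simp
      | add x y hx hy => simp only [map_add, hx, hy]
      | tmul u v => simp [hS.map_mul]
    have h₂ : ∀ (d : A) (z : A ⊗[ℂ] B), LinearEquiv.rTensor B S ((inl B (S.symm d)).lmul z) =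
        (inl B d).rmul (LinearEquiv.rTensor B S z) := by
      intro d z
      induction z with
      | zero => simp
      | add x y hx hy => simp only [map_add, hx, hy]
      | tmul u v => simp [hS.map_mul]
    have h₃ : ∀ (d : B) (z : A ⊗[ℂ] B), LinearEquiv.rTensor B S ((inr A d).rmul z) =
        (inr A d).rmul (LinearEquiv.rTensor B S z) := by
      intro d z
      induction z with
      | zero => simp
      | add x y hx hy => simp only [map_add, hx, hy]
      | tmul u v => simp
    have h₄ : ∀ (d : B) (z : A ⊗[ℂ] B), LinearEquiv.rTensor B S ((inr A d).lmul z) =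
        (inr A d).lmul (LinearEquiv.rTensor B S z) := by
      intro d z
      induction z with
      | zero => simp
      | add x y hx hy => simp only [map_add, hx, hy]
      | tmul u v => simp
    have h₅ : LinearEquiv.rTensor B S X =
        ((V⁻¹ : (Mult (A ⊗[ℂ] B))ˣ) : Mult (A ⊗[ℂ] B)).lmul (a' ⊗ₜ b') := hX'
    have h₆ : ∀ z, LinearEquiv.rTensor B S (S.symm.toLinearMap.rTensor B z) = z := by
      intro z
      induction z with
      | zero => simp
      | add x y hx hy => simp only [map_add, hx, hy]
      | tmul u v => simp
    rw [h₃, h₂, h₆, h₁, h₄, h₅, ← mul_rmul, ← mul_lmul, inl_mul_inr, inl_mul_inr, incl_rmul,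
      incl_lmul, rmul_mul]
  · rw [← LinearMap.comp_apply, ← LinearMap.rTensor_comp]
    simp

omit h hφ in
theorem _root_.AlgQuantumGroup.IsAntipodeTensorId.unique (hA : IsNondegenerateAlg A)
    (hB : IsNondegenerateAlg B) {S : A ≃ₗ[ℂ] A} {V W W' : Mult (A ⊗[ℂ] B)}
    (hW : IsAntipodeTensorId S V W) (hW' : IsAntipodeTensorId S V W') : W = W' := by
  have hAB := isNondegenerateAlg_tensor hA hB
  refine ext_lmul hAB fun w => ?_
  induction w with
  | zero => simp
  | add x y hx hy => simp only [map_add, hx, hy]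
  | tmul a b =>
    obtain ⟨x, hx, hx'⟩ := (hW a b).1
    obtain ⟨y, hy, hy'⟩ := (hW' a b).1
    rw [hx', hy', incl_injective hAB (hx.trans hy.symm)]

/-- If ω = η(c ·) = θ(· a), both sides are slices of one element of A ⊙ B, except that c is missing
on one side and a on the other. A local unit e with (e ⊗ 1)W(a ⊗ x) = W(a ⊗ x) and c e = c lets θ(·
a) be exchanged for η(c ·). -/
theorem mul_sliceLeft_eq (hB : IsNondegenerateAlg B) (W : Mult (A ⊗[ℂ] B)) {η θ : Module.Dual ℂ A} {a c : A}
    (hω : ∀ x, η (c * x) = θ (x * a)) (x y : B) :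
    y * sliceLeft B θ (W.lmul (a ⊗ₜ x)) = sliceLeft B η (W.rmul (c ⊗ₜ y)) * x := by
  obtain ⟨e, he, hce⟩ := h.exists_unit hφ (W.lmul (a ⊗ₜ x)) c
  have h₁ : (inl B e).lmul (W.lmul (a ⊗ₜ x)) = W.lmul (a ⊗ₜ x) := he
  have h₂ : η ∘ₗ LinearMap.mulLeft ℂ c = θ ∘ₗ LinearMap.mulRight ℂ a := LinearMap.ext hω
  have h₃ : ∀ u : A ⊗[ℂ] B, u * a ⊗ₜ x = (inl B a).rmul ((inr A x).rmul u) := fun u => by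
    rw [← mul_rmul, inr_mul_inl, incl_rmul]
  rw [← sliceLeft_inr_lmul, ← h₁, ← mul_lmul, inr_mul_inl, incl_lmul, ← rmul_mul, h₃,
    sliceLeft_inl_rmul, ← h₂, sliceLeft_inr_rmul, ← sliceLeft_inl_lmul,
    lmul_rmul_comm (isNondegenerateAlg_tensor h.nondeg hB), inl_lmul_tmul, hce]

/-- The form θ(· a) supplies the left action and η(c ·) the right one. Their compatibility yields
the multiplier identities and also independence of the presentation of ω. -/
theorem existsUnique_isSlice (hB : IsNondegenerateAlg B) (W : Mult (A ⊗[ℂ] B))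
    {ω η θ : Module.Dual ℂ A} {a c : A} (hη : ∀ x, ω x = η (c * x)) (hθ : ∀ x, ω x = θ (x * a)) :
    ∃! m, IsSlice W ω m := by
  have key : ∀ (a : A) (θ : Module.Dual ℂ A), ω = lact a θ → ∀ x y : B,
      y * sliceLeft B θ (W.lmul (a ⊗ₜ x)) = sliceLeft B η (W.rmul (c ⊗ₜ y)) * x :=
    fun a θ hω => h.mul_sliceLeft_eq hφ hB W fun x => by rw [← hη, hω, lact_apply]
  have hω : ω = lact a θ := LinearMap.ext hθ
  let L : B →ₗ[ℂ] B := sliceLeft B θ ∘ₗ W.lmul ∘ₗ TensorProduct.mk ℂ A B a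
  let R : B →ₗ[ℂ] B := sliceLeft B η ∘ₗ W.rmul ∘ₗ TensorProduct.mk ℂ A B c
  have hLR : ∀ x y, R x * y = x * L y := fun x y => (key a θ hω y x).symm
  refine ⟨Mult.mk L R (fun x y => sub_eq_zero.1 (hB.2 _ fun b => ?_))
    (fun x y => sub_eq_zero.1 (hB.1 _ fun b => ?_)) hLR, ⟨⟨a, θ, hω⟩, fun a' θ' hω' x => ?_⟩,
    fun m hm => ext_lmul hB fun x => hm.2 a θ hω x⟩
  · rw [mul_sub, ← hLR, ← mul_assoc, ← mul_assoc, hLR, sub_self]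
  · rw [sub_mul, hLR, mul_assoc, mul_assoc, hLR, sub_self]
  · refine sub_eq_zero.1 (hB.2 _ fun y => ?_)
    change y * (L x - _) = 0
    rw [mul_sub, ← hLR, key a' θ' hω', sub_eq_zero]
    rfl

end IsGaloisMaps

end Corepresentations

end AlgQuantumGroup

end

/-! ### The theorem -/

open scoped TensorProduct in
open AlgQuantumGroup AlgQuantumGroup.Mult in
theorem mainTheorem7
    {A : Type*} [NonUnitalRing A] [Module ℂ A] [IsScalarTower ℂ A A] [SMulCommClass ℂ A A]
    (Δ : A →ₙₐ[ℂ] Mult (A ⊗[ℂ] A)) (hΔ : IsAlgebraicQuantumGroup Δ)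
    (φ : Module.Dual ℂ A) (hφ : IsLeftHaar Δ φ)
    {B : Type*} [NonUnitalRing B] [Module ℂ B] [IsScalarTower ℂ B B] [SMulCommClass ℂ B B]
    (hB : IsNondegenerateAlg B)
    (V : (Mult (A ⊗[ℂ] B))ˣ) (hV : IsCorepresentation Δ (V : Mult (A ⊗[ℂ] B))) :
    ((∃! W : Mult (A ⊗[ℂ] B), IsAntipodeTensorId (antipode Δ) (V : Mult (A ⊗[ℂ] B)) W) ∧
      antipodeTensorId (antipode Δ) (V : Mult (A ⊗[ℂ] B)) =
        ((V⁻¹ : (Mult (A ⊗[ℂ] B))ˣ) : Mult (A ⊗[ℂ] B))) ∧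
    ∃ hS : ∀ ω ∈ dualSpace φ, ω ∘ₗ (antipode Δ).toLinearMap ∈ dualSpace φ,
      ∀ ω : dualSpace φ,
        (∃! m : Mult B, IsSlice ((V⁻¹ : (Mult (A ⊗[ℂ] B))ˣ) : Mult (A ⊗[ℂ] B)) ω.1 m) ∧
        (∃! m : Mult B, IsSlice (V : Mult (A ⊗[ℂ] B))
          (ω.1 ∘ₗ (antipode Δ).toLinearMap) m) ∧
        slice ((V⁻¹ : (Mult (A ⊗[ℂ] B))ˣ) : Mult (A ⊗[ℂ] B)) ω.1 =
          corepMap φ (V : Mult (A ⊗[ℂ] B))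
            ⟨ω.1 ∘ₗ (antipode Δ).toLinearMap, hS ω.1 ω.2⟩ := by
  obtain ⟨T₁, T₂, T₃, T₄, h⟩ := hΔ.regular.exists_galoisMaps
  have hS := h.antipode_isAntipode hφ
  have hε := h.counit_isCounit hφ
  have hAB := isNondegenerateAlg_tensor h.nondeg hB
  have hinv := h.isAntipodeTensorId_inv hφ hB V hV
  refine ⟨⟨⟨_, hinv, fun W hW => hW.unique h.nondeg hB hinv⟩, ?_⟩, ?_⟩
  · rw [antipodeTensorId, dif_pos ⟨_, hinv⟩]
    exact IsAntipodeTensorId.unique h.nondeg hB (Exists.choose_spec _) hinv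
  have hdual : ∀ ω ∈ dualSpace φ, ∃ b, ∀ x, ω x = φ (b * x) := by
    rintro _ ⟨b, rfl⟩
    exact ⟨b, fun x => rfl⟩
  have hlact : ∀ ω ∈ dualSpace φ, ∃ c, ∀ x, ω x = (φ ∘ₗ (antipode Δ).toLinearMap) (x * c) := by
    intro ω hω
    obtain ⟨b, hb⟩ := hdual ω hω
    obtain ⟨c, hc⟩ := h.exists_haar_eq_antipode hS hε hφ b
    exact ⟨c, fun x => (hb x).trans (hc x)⟩
  have hmem : ∀ ω ∈ dualSpace φ, ω ∘ₗ (antipode Δ).toLinearMap ∈ dualSpace φ := by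
    intro ω hω
    obtain ⟨b, hb⟩ := hdual ω hω
    -- For ω = φ(b ·), ω(S(x)) = φ(b S(x)) = φ(S(x S⁻¹(b))), which is again of the form φ(c x).
    obtain ⟨c, hc⟩ := h.exists_haar_antipode_eq hS hε hφ ((antipode Δ).symm b)
    refine ⟨c, LinearMap.ext fun x => ?_⟩
    change φ (c * x) = ω (antipode Δ x)
    rw [hb, ← hc, hS.map_mul, LinearEquiv.apply_symm_apply]
  refine ⟨hmem, fun ω => ?_⟩
  have hex : ∀ (W : Mult (A ⊗[ℂ] B)), ∀ ω ∈ dualSpace φ, ∃! m, IsSlice W ω m := by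
    intro W ω hω
    obtain ⟨b, hb⟩ := hdual ω hω
    obtain ⟨c, hc⟩ := hlact ω hω
    exact h.existsUnique_isSlice hφ hB W hb hc
  have hslice : ∀ (W : Mult (A ⊗[ℂ] B)), ∀ ω ∈ dualSpace φ, IsSlice W ω (slice W ω) := by
    intro W ω hω
    rw [slice, dif_pos (hex W ω hω).exists]
    exact Exists.choose_spec _
  refine ⟨hex _ _ ω.2, hex _ _ (hmem _ ω.2), ext_lmul hB fun x => ?_⟩
  change _ = (slice (V : Mult (A ⊗[ℂ] B)) (ω.1 ∘ₗ (antipode Δ).toLinearMap)).lmul x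
  obtain ⟨a, ha⟩ := hlact ω.1 ω.2
  obtain ⟨a', ha'⟩ := hlact _ (hmem ω.1 ω.2)
  rw [(hslice _ _ ω.2).2 a (φ ∘ₗ (antipode Δ).toLinearMap) (LinearMap.ext ha),
    (hslice _ _ (hmem _ ω.2)).2 a' (φ ∘ₗ (antipode Δ).toLinearMap) (LinearMap.ext ha')]
  obtain ⟨X, hX, hX'⟩ := h.exists_inl_mul_corepresentation_mul_inr hφ hB V hV a x
  set θ := φ ∘ₗ (antipode Δ).toLinearMap with hθ
  -- With ω = θ(· a), Ŝ(ω) is both (θ ∘ S)(S⁻¹(a) ·) and θ(· a'). The first form matches the element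
  -- (S⁻¹(a) ⊗ 1)V(1 ⊗ x) describing V⁻¹(a ⊗ x); the second is the one defining the slice of V.
  have hη : ∀ y, (θ ∘ₗ (antipode Δ).toLinearMap) ((antipode Δ).symm a * y) = θ (y * a') := by
    intro y
    rw [← ha']
    change θ (antipode Δ ((antipode Δ).symm a * y)) = ω.1 (antipode Δ y)
    rw [ha, hS.map_mul, LinearEquiv.apply_symm_apply]
  have hθX : sliceLeft B θ ((antipode Δ).toLinearMap.rTensor B X) =
      sliceLeft B (θ ∘ₗ (antipode Δ).toLinearMap) X := by
    simp [sliceLeft, LinearMap.rTensor_comp]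
  rw [← hX', hθX]
  -- After left multiplication by y, both sides are θ ∘ S applied to the first leg of (S⁻¹(a) ⊗
  -- y)V(1 ⊗ x).
  refine sub_eq_zero.1 (hB.2 _ fun y => ?_)
  rw [mul_sub, h.mul_sliceLeft_eq hφ hB (V : Mult (A ⊗[ℂ] B)) hη, ← sliceLeft_inr_lmul,
    ← sliceLeft_inr_rmul, sub_eq_zero]
  congr 1
  apply incl_injective hAB
  rw [← mul_incl, hX, ← incl_mul, ← incl_mul, ← inr_mul_inl]
  simp only [mul_assoc]
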